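/- Conventions. Let $d\ge 0$ be an integer; points of $\mathbb R^{2d}$ are written $z=(x,\omega)$ with $x,\omega\in\mathbb R^d$, and $B_r(z)$ is the open Euclidean ball, $B_r=B_r(0)$. A set $\Lambda\subset\mathbb R^{2d}$ is *Delone* if it is uniformly discrete and relatively dense. Its $r$-*patches* are the sets $B_r(z)\cap\Lambda$ with $z\in\Lambda$. A Delone set $\Lambda$ is a *quasicrystal* if (FLC) for each $r>0$ there are only finitely many $r$-patches up to translation, and (UCF) for each $r>0$ and each $r$-patch $P$ of $\Lambda$ the limit $$\lim_{R\to\infty}\frac{\#\{v\in\mathbb R^{2d} : P-v\subset \Lambda\cap B_R(z)\}}{\mathrm{vol}(B_R)}$$ exists uniformly in $z\in\mathbb R^{2d}$ and does not depend on $z$. For Delone sets $\Lambda,\Lambda'$ let $R(\Lambda,\Lambda')$ be the supremum of all $r>0$ for which there is $z$ with $|z|<1/r$ and $B_r\cap(\Lambda-z)=\Lambda'\cap B_r$, and let $d(\Lambda,\Lambda')=\min\{1,1/R(\Lambda,\Lambda')\}$. The *hull* $\Omega_\Lambda$ is the closure of $\{\Lambda-z : z\in\mathbb R^{2d}\}$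 with respect to $d$ in the space of Delone sets. Let $\pi(x,\omega)f(t)=e^{2\pi i\omega\cdot t}f(t-x)$. Fix a non-zero $\varphi\in\mathcal S(\mathbb R^d)$ and put $V_\varphi f(z)=\langle f,\pi(z)\varphi\rangle$ for $f\in\mathcal S'(\mathbb R^d)$. For $1\le p\le\infty$ let $M^p(\mathbb R^d)=\{f\in\mathcal S'(\mathbb R^d) : V_\varphi f\in L^p(\mathbb R^{2d})\}$ with $\|f\|_{M^p}=\|V_\varphi f\|_{L^p}$. For $f\in M^p(\mathbb R^d)$ and $h\in M^1(\mathbb R^d)$ let $\langle f,h\rangle=\|\varphi\|_2^{-2}\int_{\mathbb R^{2d}}V_\varphi f(z)\overline{V_\varphi h(z)}\,dz$. For $g_1,\dots,g_N\in M^1(\mathbb R^d)$ and $T\subset\mathbb R^{2d}$, let $\mathcal G(g_1,\dots,g_N,T)$ be the family $(\pi(z)g_i)_{1\le i\le N,\ z\in T}$. It is a *multiwindow Gabor frame* for $L^2(\mathbb R^d)$ if there are $A,B>0$ with $A\|f\|_2^2\le\sum_{i}\sum_{z\in T}|\langle f,\pi(z)g_i\rangle|^2\le B\|f\|_2^2$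 for all $f\in L^2(\mathbb R^d)$, and an $M^p$-*frame* if there are $A,B>0$ with $A\|f\|_{M^p}\le\big\|(\langle f,\pi(z)g_i\rangle)_{i,z}\big\|_{\ell^p}\le B\|f\|_{M^p}$ for all $f\in M^p(\mathbb R^d)$. **Theorem.** Let $\Lambda\subset\mathbb R^{2d}$ be a quasicrystal. Then there are $g\in M^1(\mathbb R^d)$, $N\in\mathbb N$ and $z_1,\dots,z_N\in\mathbb R^{2d}$ such that, with $g_i=\pi(z_i)g$, for every $T\in\Omega_\Lambda$ the system $\mathcal G(g_1,\dots,g_N,T)$ is a multiwindow Gabor frame for $L^2(\mathbb R^d)$ and an $M^p$-frame for all $1\le p\le\infty$. -/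

import Mathlib

open MeasureTheory Set Filter Topology
open scoped ENNReal SchwartzMap InnerProductSpace Pointwise

noncomputable section

namespace GaborQC

/-! ### Point sets in Euclidean space -/

section PointSets

variable {V : Type*} [NormedAddCommGroup V] [InnerProductSpace ℝ V] [FiniteDimensional ℝ V]
  [MeasurableSpace V] [BorelSpace V]

/-- A set is Delone if it is uniformly discrete and relatively dense, that is, if it carries a
Mathlib `DeloneSet` structure (some packing radius and some covering radius). -/
def IsDelone (Λ : Set V) : Prop :=
  ∃ D : Delone.DeloneSet V, (D : Set V) = Λ

/-- The translate `Λ - z`. -/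
def shiftSet (Λ : Set V) (z : V) : Set V := (-z) +ᵥ Λ

/-- The `r`-patches of `Λ`: the sets `B_r(z) ∩ Λ` with `z ∈ Λ` (`B_r(z)` the open ball). -/
def patches (Λ : Set V) (r : ℝ) : Set (Set V) :=
  {P | ∃ z ∈ Λ, P = Metric.ball z r ∩ Λ}

/-- Finite local complexity: for each `r > 0` there are only finitely many `r`-patches
up to translation. -/
def HasFLC (Λ : Set V) : Prop :=
  ∀ r : ℝ, 0 < r → ∃ F : Set (Set V), F.Finite ∧
    ∀ P ∈ patches Λ r, ∃ Q ∈ F, ∃ t : V, P = shiftSet Q t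

/-- The number of times the patch `P` appears in the part of `Λ` lying in the region `A`: the
number of `z` such that `P - z ⊆ Λ ∩ A`. (For `P` nonempty, `Λ` Delone, and `A` bounded this set
of vectors is finite.) -/
def patchCount (Λ P A : Set V) : ℕ :=
  {z : V | shiftSet P z ⊆ Λ ∩ A}.ncard

/-- `P` has frequency `c` in `Λ`: the number of appearances of `P` in a ball of radius `r`, divided
by the volume of the ball, tends to `c` as `r → ∞`, uniformly in the centre of the ball. -/
def HasPatchFrequency (Λ P : Set V) (c : ℝ) : Prop :=
  TendstoUniformly
    (fun (r : ℝ) (z : V) =>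
      (patchCount Λ P (Metric.ball z r) : ℝ) / (volume (Metric.ball (0 : V) r)).toReal)
    (fun _ => c) atTop

/-- Uniform cluster frequencies: every patch of `Λ` has a frequency. -/
def HasUCF (Λ : Set V) : Prop :=
  ∀ r : ℝ, 0 < r → ∀ P ∈ patches Λ r, ∃ c : ℝ, HasPatchFrequency Λ P c

/-- A quasicrystal is a Delone set of finite local complexity with uniform cluster frequencies. -/
structure IsQuasicrystal (Λ : Set V) : Prop where
  delone : IsDelone Λ
  flc : HasFLC Λ
  ucf : HasUCF Λ

/-- `R(Λ, Λ')`, the supremum in `[0, ∞]` of all `r > 0` such that for some `z` with `‖z‖ < 1 / r`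
the sets `Λ - z` and `Λ'` agree on the open ball `B_r` about the origin. -/
def agreementRadius (Λ Λ' : Set V) : ℝ≥0∞ :=
  sSup {ρ : ℝ≥0∞ | ∃ r : ℝ, 0 < r ∧ ρ = ENNReal.ofReal r ∧ ∃ z : V, ‖z‖ < 1 / r ∧
    Metric.ball 0 r ∩ shiftSet Λ z = Λ' ∩ Metric.ball 0 r}

/-- The distance `d(Λ, Λ') = min {1, 1 / R(Λ, Λ')}` (with `1 / 0 = ∞` and `1 / ∞ = 0`). -/
def patternDist (Λ Λ' : Set V) : ℝ≥0∞ := min 1 (agreementRadius Λ Λ')⁻¹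

/-- The hull of `Λ`: the closure of the orbit `{Λ - z | z ∈ V}` in the space of Delone sets with
the distance `d`. -/
def hull (Λ : Set V) : Set (Set V) :=
  {T | IsDelone T ∧ ∀ ε : ℝ≥0∞, 0 < ε → ∃ z : V, patternDist (shiftSet Λ z) T < ε}

end PointSets

/-! ### Frames -/

/-- A family `e` in a Hilbert space is a frame if there are `A, B > 0` such that
`A ‖f‖² ≤ ∑ⱼ |⟨f, eⱼ⟩|² ≤ B ‖f‖²` for all `f`. -/
def IsFrame {H J : Type*} [NormedAddCommGroup H] [InnerProductSpace ℂ H] (e : J → H) : Prop :=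
  ∃ A B : ℝ, 0 < A ∧ 0 < B ∧ ∀ f : H,
    Summable (fun j => ‖⟪e j, f⟫_ℂ‖ ^ 2) ∧
    A * ‖f‖ ^ 2 ≤ ∑' j, ‖⟪e j, f⟫_ℂ‖ ^ 2 ∧ ∑' j, ‖⟪e j, f⟫_ℂ‖ ^ 2 ≤ B * ‖f‖ ^ 2

/-! ### Time-frequency analysis -/

/-- The space `ℝᵈ`. -/
abbrev Sp (d : ℕ) := EuclideanSpace ℝ (Fin d)

/-- The time-frequency space `ℝ²ᵈ = ℝᵈ × ℝᵈ` with its Euclidean norm. A point `z = (x, ω)` has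
components `x = z.fst` and `ω = z.snd`. -/
abbrev TF (d : ℕ) := WithLp 2 (Sp d × Sp d)

/-- The Hilbert space `L²(ℝᵈ)`. -/
abbrev L2 (d : ℕ) := Lp ℂ 2 (volume : Measure (Sp d))

variable {d : ℕ}

/-- The character `t ↦ e^{2 π i ω · t}`. -/
def tfChar (ω t : Sp d) : ℂ := Complex.exp (2 * Real.pi * Complex.I * (⟪ω, t⟫_ℝ : ℝ))

theorem norm_tfChar (ω t : Sp d) : ‖tfChar ω t‖ = 1 := by
  have h : (2 * Real.pi * Complex.I * (⟪ω, t⟫_ℝ : ℝ) : ℂ)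
      = ((2 * Real.pi * ⟪ω, t⟫_ℝ : ℝ) : ℂ) * Complex.I := by
    push_cast; ring
  rw [tfChar, h, Complex.norm_exp_ofReal_mul_I]

theorem continuous_tfChar (ω : Sp d) : Continuous (tfChar ω) := by
  unfold tfChar
  fun_prop

theorem hasTemperateGrowth_tfChar (ω : Sp d) : (tfChar ω).HasTemperateGrowth := by
  have he : Function.HasTemperateGrowth
      (fun s : ℝ => Complex.exp (2 * Real.pi * Complex.I * (s : ℂ))) := by
    refine ⟨(contDiff_const.mul Complex.ofRealCLM.contDiff).cexp, fun n => ⟨0, (2 * Real.pi) ^ n, fun s => ?_⟩⟩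
    have hd : ∀ n : ℕ, iteratedDeriv n
        (fun s : ℝ => Complex.exp (2 * Real.pi * Complex.I * (s : ℂ)))
        = fun s : ℝ => (2 * Real.pi * Complex.I) ^ n *
            Complex.exp (2 * Real.pi * Complex.I * (s : ℂ)) := by
      intro n
      induction n with
      | zero => ext s; simp
      | succ k ih =>
        rw [iteratedDeriv_succ, ih]
        ext s
        have h1 : HasDerivAt (fun s : ℝ => (2 * Real.pi * Complex.I * (s : ℂ)))
            (2 * Real.pi * Complex.I) s := by
          simpa using (Complex.ofRealCLM.hasDerivAt (x := s)).const_mul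
            (2 * Real.pi * Complex.I : ℂ)
        rw [(h1.cexp.const_mul ((2 * Real.pi * Complex.I : ℂ) ^ k)).deriv]
        ring
    rw [norm_iteratedFDeriv_eq_norm_iteratedDeriv, hd]
    have h2 : (2 * Real.pi * Complex.I * (s : ℂ)) = ((2 * Real.pi * s : ℝ) : ℂ) * Complex.I := by
      push_cast; ring
    rw [norm_mul, h2, Complex.norm_exp_ofReal_mul_I]
    simp [abs_of_pos Real.pi_pos]
  exact he.comp (Function.hasTemperateGrowth_inner_right ω)

/-- The time-frequency shift `π(x, ω) f (t) = e^{2 π i ω · t} f (t - x)` of a function. -/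
def shiftFun (z : TF d) (f : Sp d → ℂ) : Sp d → ℂ :=
  fun t => tfChar z.snd t * f (t - z.fst)

theorem memLp_shiftFun (z : TF d) {f : Sp d → ℂ} (hf : MemLp f 2 volume) :
    MemLp (shiftFun z f) 2 volume := by
  have h1 : MemLp (fun t => f (t - z.fst)) 2 volume :=
    hf.comp_measurePreserving (measurePreserving_sub_right volume z.fst)
  refine h1.of_le ((continuous_tfChar z.snd).aestronglyMeasurable.mul h1.1) ?_
  filter_upwards with t
  simp [shiftFun, norm_tfChar]

/-- The time-frequency shift `π(z)` on `L²(ℝᵈ)`. -/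
def shiftL2 (z : TF d) (f : L2 d) : L2 d :=
  (memLp_shiftFun z (Lp.memLp f)).toLp (shiftFun z f)

/-- The time-frequency shift `π(z)` on Schwartz functions. -/
def shiftSchwartz (z : TF d) (φ : 𝓢(Sp d, ℂ)) : 𝓢(Sp d, ℂ) :=
  SchwartzMap.smulLeftCLM ℂ (tfChar z.snd) (SchwartzMap.compSubConstCLM ℂ z.fst φ)

theorem shiftSchwartz_apply (z : TF d) (φ : 𝓢(Sp d, ℂ)) (t : Sp d) :
    shiftSchwartz z φ t = shiftFun z φ t := by
  simp [shiftSchwartz, shiftFun,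
    SchwartzMap.smulLeftCLM_apply_apply (hasTemperateGrowth_tfChar z.snd)]

/-- The complex conjugate of a Schwartz function. -/
def conjSchwartz (φ : 𝓢(Sp d, ℂ)) : 𝓢(Sp d, ℂ) :=
  SchwartzMap.postcompCLM (𝕜 := ℝ) (Complex.conjCLE : ℂ →L[ℝ] ℂ) φ

theorem conjSchwartz_apply (φ : 𝓢(Sp d, ℂ)) (t : Sp d) :
    conjSchwartz φ t = starRingEnd ℂ (φ t) := rfl

/-- The short-time Fourier transform `V_φ f (z) = ⟨f, π(z) φ⟩` of a tempered distribution `f` with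
Schwartz window `φ`: the distribution `f` is applied to the conjugate of `π(z) φ`. -/
def stft (φ : 𝓢(Sp d, ℂ)) (f : 𝓢'(Sp d, ℂ)) (z : TF d) : ℂ :=
  f (conjSchwartz (shiftSchwartz z φ))

/-- For `f ∈ L²`, viewed as a tempered distribution, the short-time Fourier transform is the usual
integral `∫ f(t) conj(φ(t - x)) e^{- 2 π i ω · t} dt`. -/
theorem stft_L2 (φ : 𝓢(Sp d, ℂ)) (f : L2 d) (z : TF d) :
    stft φ (f : 𝓢'(Sp d, ℂ)) z =
      ∫ t, f t * starRingEnd ℂ (φ (t - z.fst)) *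
        Complex.exp (-(2 * Real.pi * Complex.I * (⟪z.snd, t⟫_ℝ : ℝ))) := by
  rw [stft, Lp.toTemperedDistribution_apply]
  refine integral_congr_ae (Eventually.of_forall fun t => ?_)
  simp only [conjSchwartz_apply, shiftSchwartz_apply, shiftFun, tfChar, map_mul, ← Complex.exp_conj,
    smul_eq_mul, Complex.conj_ofReal, Complex.conj_I, map_ofNat]
  rw [show (2 * (Real.pi : ℂ) * -Complex.I * (⟪z.snd, t⟫_ℝ : ℝ)) =
    -(2 * Real.pi * Complex.I * (⟪z.snd, t⟫_ℝ : ℝ)) by ring]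
  ring

/-- Membership in the modulation space `Mᵖ(ℝᵈ)` (defined by the Schwartz window `φ ≠ 0`):
`V_φ f ∈ Lᵖ(ℝ²ᵈ)`. -/
def MemM (φ : 𝓢(Sp d, ℂ)) (p : ℝ≥0∞) (f : 𝓢'(Sp d, ℂ)) : Prop :=
  MemLp (stft φ f) p volume

/-- The norm `‖f‖_{Mᵖ} = ‖V_φ f‖_{Lᵖ}` of an element of `Mᵖ(ℝᵈ)`. -/
def normM (φ : 𝓢(Sp d, ℂ)) (p : ℝ≥0∞) (f : 𝓢'(Sp d, ℂ)) : ℝ :=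
  (eLpNorm (stft φ f) p volume).toReal

/-- The duality pairing `⟨f, g⟩ = ‖φ‖₂⁻² ∫ V_φ f(z) conj(V_φ g(z)) dz` of `f ∈ Mᵖ(ℝᵈ)` with
`g ∈ M¹(ℝᵈ)`, conjugate-linear in `g`. It extends the inner product of `L²(ℝᵈ)` and the action of
tempered distributions on Schwartz functions; the integral converges absolutely
since `V_φ f ∈ L^∞` and `V_φ g ∈ L¹`. -/
def pairM (φ : 𝓢(Sp d, ℂ)) (f g : 𝓢'(Sp d, ℂ)) : ℂ :=
  ((∫ t, ‖φ t‖ ^ 2 : ℝ) : ℂ)⁻¹ * ∫ z : TF d, stft φ f z * starRingEnd ℂ (stft φ g z)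

/-- The multiwindow Gabor system `G(g₁, …, g_N, T)`: the family `π(z) gᵢ` indexed by
`i = 1, …, N` and `z ∈ T`. -/
def gaborSystem {N : ℕ} (g : Fin N → L2 d) (T : Set (TF d)) : Fin N × T → L2 d :=
  fun j => shiftL2 (j.2 : TF d) (g j.1)

/-- The family `e` (of elements of `M¹(ℝᵈ)`) is an `Mᵖ`-frame: the analysis operator
`f ↦ (⟨f, eⱼ⟩)ⱼ` maps `Mᵖ(ℝᵈ)` boundedly into `ℓᵖ` and is bounded below. -/
def IsMFrame {J : Type*} (φ : 𝓢(Sp d, ℂ)) (p : ℝ≥0∞) (e : J → L2 d) : Prop :=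
  ∃ A B : ℝ, 0 < A ∧ 0 < B ∧ ∀ f : 𝓢'(Sp d, ℂ), MemM φ p f →
    ∃ c : lp (fun _ : J => ℂ) p, (∀ j, c j = pairM φ f (e j : 𝓢'(Sp d, ℂ))) ∧
      A * normM φ p f ≤ ‖c‖ ∧ ‖c‖ ≤ B * normM φ p f

end GaborQC

end

/-! The window `g` is `φ` itself, and the frame inequalities are sampling inequalities for the
short-time Fourier transform. Since `π(z)π(u)φ` equals `π(z + u)φ` up to a unimodular factor, the
coefficients of `f` against the system with windows `π(ζ i)φ` over `T` have the moduli `|V_φ f(t + ζ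
i)|`, `t ∈ T`. It remains to recover the `L^p` norm of `V_φ f` from these samples, for all `p` at
once.

The reproducing formula (`integral_stft_mul_stftConj`), valid for every tempered distribution,
bounds `|f(conj χ)|` by the integral of `|V_φ f| |V_φ χ|`, up to the constant `‖φ‖₂²`. Taking `χ =
π(z)(π(u)φ - φ)`, with `u` small, shows that `|V_φ f|` changes on the scale `ε` by at most its
correlation with a kernel `K` (`exists_oscBound`). Time-frequency shifts are continuous on Schwartz
space and `V_φ` of a Schwartz function decays rapidly, so `∫ K ≤ 1/2` for small `ε`, with `ε` and
`K` independent of `f` and `p`. By Young's inequality the correlation has `L^p` norm at most half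
that of `V_φ f`, so the error is absorbed (`exists_sampling_bounds`): an `ε`-dense sample set gives
the lower bound, and finitely many uniformly discrete pieces give the upper bound.

All members of the hull share one covering radius `ρ` (`exists_covering_radius_hull`), so a finite
`ε`-net `ζ` of the closed `ρ`-ball makes every `T + {ζ i}` an `ε`-dense set (`exists_finite_net`).
The `L²` statement is the case `p = 2` combined with Moyal's identity (`eLpNorm_stft_L2`). -/

noncomputable section

namespace GaborQC

/-! ### Covering radii in the hull and finite nets. -/

section Geometry

variable {V : Type*} [NormedAddCommGroup V]

/-- Elements of the hull are relatively dense with (almost) the covering radius of the set. -/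
theorem exists_covering_radius_hull [InnerProductSpace ℝ V] [FiniteDimensional ℝ V]
    [MeasurableSpace V] [BorelSpace V] {Λ : Set V} (hΛ : IsDelone Λ) :
    ∃ ρ : ℝ, 0 < ρ ∧ ∀ T ∈ hull Λ, ∀ z : V, ∃ t ∈ T, dist z t ≤ ρ := by
  obtain ⟨D, rfl⟩ := hΛ
  refine ⟨D.coveringRadius, by exact_mod_cast D.coveringRadius_pos, fun T hT z => ?_⟩
  have hc : 0 < (D.coveringRadius : ℝ) := by exact_mod_cast D.coveringRadius_pos
  obtain ⟨-, hT⟩ := hT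
  -- The ball of radius `s` contains everything within the covering radius of `z`. Also `s ≥ 1`, so
  -- the cutoff at `1` in `patternDist` plays no role at the threshold `1 / s`.
  set s : ℝ := ‖z‖ + D.coveringRadius + 1 with hs
  have hs0 : 1 ≤ s := by have := norm_nonneg z; linarith
  obtain ⟨v, hv⟩ := hT (ENNReal.ofReal s)⁻¹ (by simp)
  have h1 : (ENNReal.ofReal s)⁻¹ ≤ 1 := by
    rw [ENNReal.inv_le_one]; simpa using hs0
  have h2 : ENNReal.ofReal s < agreementRadius (shiftSet (D : Set V) v) T := by
    rw [patternDist, min_lt_iff] at hv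
    rcases hv with hv | hv
    · exact absurd hv (not_lt.mpr h1)
    · exact ENNReal.inv_lt_inv.mp hv
  obtain ⟨_, ⟨r, hr, rfl, y, -, hy⟩, hlt⟩ := lt_sSup_iff.mp h2
  have hsr : s < r := (ENNReal.ofReal_lt_ofReal_iff hr).mp hlt
  -- Undoing both shifts turns `z` into `z + y + v`. A nearby point of the original set is then
  -- shifted back into the ball where the two patterns agree.
  obtain ⟨p, hp, hpd⟩ := D.exists_dist_le_coveringRadius (z + y + v)
  have hd : dist z (p - v - y) = dist (z + y + v) p := by
    rw [dist_eq_norm, dist_eq_norm]; congr 1; abel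
  have hmem : p - v - y ∈ Metric.ball 0 r ∩ shiftSet (shiftSet (D : Set V) v) y := by
    refine ⟨?_, ?_⟩
    · rw [mem_ball_zero_iff]
      have : ‖p - v - y‖ ≤ ‖z‖ + dist z (p - v - y) := by
        rw [dist_comm, dist_eq_norm]
        simpa using norm_add_le z (p - v - y - z)
      rw [hd] at this
      linarith
    · refine ⟨p - v, ⟨p, hp, ?_⟩, ?_⟩ <;> simp [sub_eq_add_neg, add_comm]
  rw [hy] at hmem
  exact ⟨_, hmem.1, by rw [hd]; exact hpd⟩

/-- A finite family of translates of a relatively dense set is `ε`-dense. -/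
theorem exists_finite_net [ProperSpace V] (ρ : ℝ) {ε : ℝ} (hε : 0 < ε) :
    ∃ (N : ℕ) (ζ : Fin N → V), ∀ T : Set V, (∀ z : V, ∃ t ∈ T, dist z t ≤ ρ) →
      ∀ z : V, ∃ j : Fin N × T, dist z (j.2 + ζ j.1) < ε := by
  -- The net approximates the displacement `z - t`, which lies in the closed `ρ`-ball whatever `T`
  -- is; hence one net serves all `T`.
  obtain ⟨s, -, hs, hcov⟩ :=
    Metric.finite_approx_of_totallyBounded (isCompact_closedBall (0 : V) ρ).totallyBounded ε hε
  obtain ⟨N, ζ, rfl⟩ := hs.fin_param.imp fun _ h => h.imp fun _ h => h.2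
  refine ⟨N, ζ, fun T hT z => ?_⟩
  obtain ⟨t, ht, hzt⟩ := hT z
  have : z - t ∈ Metric.closedBall (0 : V) ρ := by
    rwa [mem_closedBall_zero_iff, ← dist_eq_norm]
  obtain ⟨_, ⟨i, rfl⟩, hi⟩ := mem_iUnion₂.mp (hcov this)
  refine ⟨(i, ⟨t, ht⟩), ?_⟩
  rw [Metric.mem_ball, dist_eq_norm] at hi
  rw [dist_eq_norm]
  convert hi using 2
  abel

end Geometry

end GaborQC

namespace GaborQC

/-! ### Sampling inequalities for functions of controlled oscillation. -/

section Sampling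

variable {V : Type*} [NormedAddCommGroup V] [InnerProductSpace ℝ V] [FiniteDimensional ℝ V]
  [MeasurableSpace V] [BorelSpace V]

/-- The correlation `z ↦ ∫ a(w) k(w - z) dw` of two nonnegative functions. -/
def corr (a k : V → ℝ≥0∞) (z : V) : ℝ≥0∞ := ∫⁻ w, a w * k (w - z)

theorem measurable_corr {a k : V → ℝ≥0∞} (ha : Measurable a) (hk : Measurable k) :
    Measurable (corr a k) := by
  unfold corr
  exact Measurable.lintegral_prod_right' (f := fun p : V × V => a p.2 * k (p.2 - p.1))
    (by fun_prop)

theorem corr_le_essSup (a : V → ℝ≥0∞) {k : V → ℝ≥0∞} (hk : Measurable k) (z : V) :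
    corr a k z ≤ (∫⁻ y, k y) * essSup a volume := by
  calc corr a k z ≤ ∫⁻ w, essSup a volume * k (w - z) :=
        lintegral_mono_ae (by
          filter_upwards [ENNReal.ae_le_essSup a] with w hw
          gcongr)
    _ = _ := by
        rw [lintegral_const_mul _ (by fun_prop), lintegral_sub_right_eq_self k z, mul_comm]

/-- Young's inequality for the correlation with an integrable kernel. -/
theorem lintegral_corr_rpow_le {a k : V → ℝ≥0∞} (ha : Measurable a) (hk : Measurable k)
    {p : ℝ} (hp : 1 ≤ p) :
    (∫⁻ z, corr a k z ^ p) ^ (1 / p) ≤ (∫⁻ y, k y) * (∫⁻ w, a w ^ p) ^ (1 / p) := by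
  have hp0 : 0 < p := by linarith
  set κ : ℝ≥0∞ := ∫⁻ y, k y with hκ
  have hpt : ∀ z, corr a k z ^ p ≤ κ ^ (p - 1) * ∫⁻ w, a w ^ p * k (w - z) := by
    intro z
    rcases hp.eq_or_lt with rfl | hp1
    · simp [corr]
    have hpq := Real.HolderConjugate.conjExponent hp1
    set q := Real.conjExponent p
    have hq0 : 0 < q := hpq.symm.pos
    -- Writing `k = k^(1/p) k^(1/q)` and applying Hölder keeps one full factor of `k` next to `a^p`,
    -- which Tonelli can then integrate out.
    have hsplit : ∀ x : ℝ≥0∞, x ^ (1 / p) * x ^ (1 / q) = x := by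
      intro x
      rw [← ENNReal.rpow_add_of_nonneg _ _ (by positivity) (by positivity), one_div, one_div,
        hpq.inv_add_inv_eq_one, ENNReal.rpow_one]
    have h1 : corr a k z ≤ (∫⁻ w, a w ^ p * k (w - z)) ^ (1 / p) * κ ^ (1 / q) := by
      calc corr a k z
          = ∫⁻ w, ((fun w => a w * k (w - z) ^ (1 / p)) * fun w => k (w - z) ^ (1 / q)) w := by
            refine lintegral_congr fun w => ?_
            simp only [Pi.mul_apply]
            rw [mul_assoc, hsplit]
        _ ≤ _ := ENNReal.lintegral_mul_le_Lp_mul_Lq volume hpq (by fun_prop) (by fun_prop)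
        _ = _ := by
            congr 2
            · refine lintegral_congr fun w => ?_
              rw [ENNReal.mul_rpow_of_nonneg _ _ hp0.le, ← ENNReal.rpow_mul,
                one_div_mul_cancel hp0.ne', ENNReal.rpow_one]
            · rw [hκ, ← lintegral_sub_right_eq_self k z]
              refine lintegral_congr fun w => ?_
              rw [← ENNReal.rpow_mul, one_div_mul_cancel hq0.ne', ENNReal.rpow_one]
    calc corr a k z ^ p ≤ ((∫⁻ w, a w ^ p * k (w - z)) ^ (1 / p) * κ ^ (1 / q)) ^ p := by gcongr
      _ = _ := by
        rw [ENNReal.mul_rpow_of_nonneg _ _ hp0.le, ← ENNReal.rpow_mul, ← ENNReal.rpow_mul,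
          one_div_mul_cancel hp0.ne', ENNReal.rpow_one, mul_comm]
        congr 2
        have : p - 1 ≠ 0 := by linarith
        simp only [q, Real.conjExponent]
        field_simp
  have hint : ∫⁻ z, corr a k z ^ p ≤ κ ^ p * ∫⁻ w, a w ^ p := by
    calc ∫⁻ z, corr a k z ^ p ≤ ∫⁻ z, κ ^ (p - 1) * ∫⁻ w, a w ^ p * k (w - z) :=
          lintegral_mono hpt
      _ = κ ^ (p - 1) * ∫⁻ w, ∫⁻ z, a w ^ p * k (w - z) := by
          rw [lintegral_const_mul, lintegral_lintegral_swap]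
          · fun_prop
          · exact Measurable.lintegral_prod_right'
              (f := fun p' : V × V => a p'.2 ^ p * k (p'.2 - p'.1)) (by fun_prop)
      _ = κ ^ (p - 1) * ∫⁻ w, a w ^ p * κ := by
          congr 1
          refine lintegral_congr fun w => ?_
          rw [lintegral_const_mul _ (by fun_prop), lintegral_sub_left_eq_self k w]
      _ = κ ^ p * ∫⁻ w, a w ^ p := by
          rw [lintegral_mul_const _ (by fun_prop), mul_comm _ κ, ← mul_assoc]
          congr 1
          nth_rewrite 2 [← ENNReal.rpow_one κ]
          rw [← ENNReal.rpow_add_of_nonneg _ _ (by linarith) zero_le_one, sub_add_cancel]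
  calc _ ≤ (κ ^ p * ∫⁻ w, a w ^ p) ^ (1 / p) := by gcongr
    _ = _ := by
      rw [ENNReal.mul_rpow_of_nonneg _ _ (by positivity), ← ENNReal.rpow_mul,
        mul_one_div_cancel hp0.ne', ENNReal.rpow_one]

/-- The function `a` oscillates at scale `ε` by at most its correlation with `k`. -/
def OscBound (a k : V → ℝ≥0∞) (ε : ℝ) : Prop :=
  ∀ z z' : V, dist z z' < ε → a z ≤ a z' + corr a k z ∧ a z ≤ a z' + corr a k z'

theorem OscBound.mono {a k : V → ℝ≥0∞} {ε ε' : ℝ} (h : OscBound a k ε) (hε : ε' ≤ ε) :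
    OscBound a k ε' :=
  fun z z' hz => h z z' (hz.trans_le hε)

/-- Each point is near a sample, so `a` is dominated by a step function built from the samples plus
the correlation evaluated at the same point. Minkowski separates the two terms and Young bounds the
second. -/
theorem lintegral_rpow_le_sum_samples {a k : V → ℝ≥0∞} (ha : Measurable a) (hk : Measurable k)
    {ε : ℝ} (hosc : OscBound a k ε) {J : Type*} [Countable J] {l : J → V}
    (hl : ∀ z, ∃ j, dist z (l j) < ε) {p : ℝ} (hp : 1 ≤ p) :
    (∫⁻ z, a z ^ p) ^ (1 / p) ≤
      (volume (Metric.ball (0 : V) ε)) ^ (1 / p) * (∑' j, a (l j) ^ p) ^ (1 / p)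
        + (∫⁻ y, k y) * (∫⁻ z, a z ^ p) ^ (1 / p) := by
  have hp0 : 0 < p := by linarith
  -- Summing over all balls avoids choosing a partition: overlaps only increase `S`, and its
  -- integral is still exactly the ball volume times the sum of samples.
  let S : V → ℝ≥0∞ := fun z => ∑' j, (Metric.ball (l j) ε).indicator (fun _ => a (l j) ^ p) z
  have hSm : Measurable S := Measurable.tsum fun j =>
    measurable_const.indicator Metric.isOpen_ball.measurableSet
  have hS : ∫⁻ z, S z = volume (Metric.ball (0 : V) ε) * ∑' j, a (l j) ^ p := by
    rw [lintegral_tsum fun j =>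
      (measurable_const.indicator Metric.isOpen_ball.measurableSet).aemeasurable,
      ← ENNReal.tsum_mul_left]
    refine tsum_congr fun j => ?_
    rw [lintegral_indicator_const Metric.isOpen_ball.measurableSet,
      Measure.addHaar_ball_center, mul_comm]
  have hle : ∀ z, a z ≤ ((fun z => S z ^ (1 / p)) + corr a k) z := by
    intro z
    obtain ⟨j, hj⟩ := hl z
    refine (hosc z (l j) hj).1.trans (add_le_add_left ?_ _)
    have h1 : a (l j) ^ p ≤ S z := by
      refine le_trans (le_of_eq ?_) (ENNReal.le_tsum j)
      rw [indicator_of_mem]; exact hj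
    calc a (l j) = (a (l j) ^ p) ^ (1 / p) := by
          rw [← ENNReal.rpow_mul, mul_one_div_cancel hp0.ne', ENNReal.rpow_one]
      _ ≤ S z ^ (1 / p) := ENNReal.rpow_le_rpow h1 (by positivity)
  calc (∫⁻ z, a z ^ p) ^ (1 / p)
      ≤ (∫⁻ z, ((fun z => S z ^ (1 / p)) + corr a k) z ^ p) ^ (1 / p) := by
        exact ENNReal.rpow_le_rpow
          (lintegral_mono fun z => ENNReal.rpow_le_rpow (hle z) hp0.le) (by positivity)
    _ ≤ _ := ENNReal.lintegral_Lp_add_le (by fun_prop) (measurable_corr ha hk).aemeasurable hp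
    _ ≤ _ := by
        refine add_le_add (le_of_eq ?_) (lintegral_corr_rpow_le ha hk hp)
        rw [← ENNReal.mul_rpow_of_nonneg _ _ (by positivity), ← hS]
        congr 1
        refine lintegral_congr fun z => ?_
        rw [← ENNReal.rpow_mul, one_div_mul_cancel hp0.ne', ENNReal.rpow_one]

/-- Each sample is at most `a + corr a k` throughout its own ball; here the second half of
`OscBound` is needed, with the correlation at the variable point. For fixed `i` the balls are
disjoint, so the integrals add up, and the finitely many `i` cost a factor `card ι`. -/
theorem sum_samples_le_lintegral_rpow {a k : V → ℝ≥0∞} (ha : Measurable a) (hk : Measurable k)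
    {ε : ℝ} (hosc : OscBound a k ε) {ι T : Type*} [Fintype ι] [Countable T] {l : ι × T → V}
    (hl : ∀ i, Pairwise fun s t => Disjoint (Metric.ball (l (i, s)) ε) (Metric.ball (l (i, t)) ε))
    {p : ℝ} (hp : 1 ≤ p) :
    (volume (Metric.ball (0 : V) ε)) ^ (1 / p) * (∑' j, a (l j) ^ p) ^ (1 / p) ≤
      (Fintype.card ι : ℝ≥0∞) ^ (1 / p) * ((1 + ∫⁻ y, k y) * (∫⁻ z, a z ^ p) ^ (1 / p)) := by
  have hp0 : 0 < p := by linarith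
  have hball : ∀ j, volume (Metric.ball (0 : V) ε) * a (l j) ^ p ≤
      ∫⁻ z in Metric.ball (l j) ε, (a + corr a k) z ^ p := by
    intro j
    calc volume (Metric.ball (0 : V) ε) * a (l j) ^ p
        = ∫⁻ z in Metric.ball (l j) ε, a (l j) ^ p := by
          rw [setLIntegral_const, Measure.addHaar_ball_center volume (l j), mul_comm]
      _ ≤ _ := by
          refine setLIntegral_mono' Metric.isOpen_ball.measurableSet fun z hz => ?_
          have := (hosc (l j) z (by rwa [dist_comm])).2
          gcongr
          exact this
  have hsum : volume (Metric.ball (0 : V) ε) * ∑' j, a (l j) ^ p ≤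
      Fintype.card ι * ∫⁻ z, (a + corr a k) z ^ p := by
    calc volume (Metric.ball (0 : V) ε) * ∑' j, a (l j) ^ p
        = ∑ i, ∑' t, volume (Metric.ball (0 : V) ε) * a (l (i, t)) ^ p := by
          rw [← ENNReal.tsum_mul_left, ENNReal.tsum_prod', tsum_fintype]
      _ ≤ ∑ i, ∑' t, ∫⁻ z in Metric.ball (l (i, t)) ε, (a + corr a k) z ^ p := by
          gcongr with i _ t
          exact hball _
      _ ≤ ∑ i : ι, ∫⁻ z, (a + corr a k) z ^ p := by
          gcongr with i _
          rw [← lintegral_iUnion (fun t => Metric.isOpen_ball.measurableSet) (hl i)]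
          exact setLIntegral_le_lintegral _ _
      _ = _ := by simp
  calc _ = (volume (Metric.ball (0 : V) ε) * ∑' j, a (l j) ^ p) ^ (1 / p) := by
        rw [ENNReal.mul_rpow_of_nonneg _ _ (by positivity)]
    _ ≤ (Fintype.card ι * ∫⁻ z, (a + corr a k) z ^ p) ^ (1 / p) := by gcongr
    _ = (Fintype.card ι : ℝ≥0∞) ^ (1 / p) * (∫⁻ z, (a + corr a k) z ^ p) ^ (1 / p) := by
        rw [ENNReal.mul_rpow_of_nonneg _ _ (by positivity)]
    _ ≤ _ := by
        gcongr
        refine (ENNReal.lintegral_Lp_add_le ha.aemeasurable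
          (measurable_corr ha hk).aemeasurable hp).trans ?_
        rw [add_mul, one_mul]
        gcongr
        exact lintegral_corr_rpow_le ha hk hp

theorem essSup_le_iSup_samples {a k : V → ℝ≥0∞} (hk : Measurable k)
    {ε : ℝ} (hosc : OscBound a k ε) {J : Type*} {l : J → V} (hl : ∀ z, ∃ j, dist z (l j) < ε) :
    essSup a volume ≤ (⨆ j, a (l j)) + (∫⁻ y, k y) * essSup a volume := by
  refine essSup_le_of_ae_le _ (Eventually.of_forall fun z => ?_)
  obtain ⟨j, hj⟩ := hl z
  exact (hosc z (l j) hj).1.trans (add_le_add (le_iSup (fun j => a (l j)) j) (corr_le_essSup a hk z))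

/-- Samples are values at single points, which an essential supremum does not see. The ball around
`z` has positive measure and so contains a point where `a` is at most its essential supremum; small
oscillation carries the bound to `z`. -/
theorem le_essSup_of_oscBound {a k : V → ℝ≥0∞} (hk : Measurable k)
    {ε : ℝ} (hε : 0 < ε) (hosc : OscBound a k ε) (z : V) :
    a z ≤ (1 + ∫⁻ y, k y) * essSup a volume := by
  have hpos : volume (Metric.ball z ε) ≠ 0 := (Metric.measure_ball_pos volume z hε).ne'
  obtain ⟨w, hw, hw'⟩ : ∃ w ∈ Metric.ball z ε, a w ≤ essSup a volume := by
    by_contra! h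
    refine hpos (measure_mono_null (t := {w | ¬ a w ≤ essSup a volume}) ?_
      (ENNReal.ae_le_essSup a))
    intro w hw
    simpa using h w hw
  rw [add_mul, one_mul]
  exact (hosc z w (by rwa [dist_comm])).1.trans (add_le_add hw' (corr_le_essSup a hk z))

end Sampling

end GaborQC

namespace GaborQC

open FourierTransform

/-! ### Translations on Schwartz space. -/

section Translation

variable {E : Type*} [NormedAddCommGroup E] [NormedSpace ℝ E]

theorem iteratedFDeriv_translate (φ : 𝓢(E, ℂ)) (n : ℕ) (x t : E) :
    iteratedFDeriv ℝ n (SchwartzMap.compSubConstCLM ℂ x φ) t = iteratedFDeriv ℝ n φ (t - x) := by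
  have : (SchwartzMap.compSubConstCLM ℂ x φ : E → ℂ) = fun s => φ (s - x) := by
    ext s; simp
  rw [this, iteratedFDeriv_comp_sub]

theorem one_add_norm_le_mul_sub {E : Type*} [NormedAddCommGroup E] (t x : E) : 1 + ‖t‖ ≤ (1 + ‖x‖) * (1 + ‖t - x‖) := by
  have h : ‖t‖ ≤ ‖x‖ + ‖t - x‖ := by simpa using norm_add_le x (t - x)
  nlinarith [mul_nonneg (norm_nonneg x) (norm_nonneg (t - x))]

theorem exists_seminorm_weighted_deriv_le (k n : ℕ) :
    ∃ q : Seminorm ℝ 𝓢(E, ℂ), Continuous q ∧ ∀ (φ : 𝓢(E, ℂ)) (t : E),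
      (1 + ‖t‖) ^ k * ‖iteratedFDeriv ℝ n φ t‖ ≤ q φ := by
  refine ⟨((2 : NNReal) ^ k) • (Finset.Iic (k, n)).sup (schwartzSeminormFamily ℝ E ℂ), ?_,
    fun φ t => ?_⟩
  · exact (Seminorm.continuous_finsetSup
      fun i _ => (schwartz_withSeminorms ℝ E ℂ).continuous_seminorm i).const_smul ((2 : NNReal) ^ k)
  · exact SchwartzMap.one_add_le_sup_seminorm_apply (𝕜 := ℝ) (m := (k, n)) le_rfl le_rfl φ t

/-- Continuous seminorms of translates grow at most polynomially. -/
theorem exists_seminorm_translate_le (q : Seminorm ℝ 𝓢(E, ℂ)) (hq : Continuous q) :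
    ∃ (k : ℕ) (q' : Seminorm ℝ 𝓢(E, ℂ)), Continuous q' ∧ ∀ (x : E) (φ : 𝓢(E, ℂ)),
      q (SchwartzMap.compSubConstCLM ℂ x φ) ≤ (1 + ‖x‖) ^ k * q' φ := by
  obtain ⟨s, C, -, hC⟩ := Seminorm.bound_of_continuous (schwartz_withSeminorms ℝ E ℂ) q hq
  choose r hr hrle using fun i : ℕ × ℕ => exists_seminorm_weighted_deriv_le (E := E) i.1 i.2
  -- The growth exponent is the largest polynomial weight among the finitely many Schwartz seminorms
  -- that dominate `q`.
  refine ⟨s.sup Prod.fst, C • s.sup r, ?_, fun x φ => ?_⟩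
  · exact (Seminorm.continuous_finsetSup fun i _ => hr i).const_smul C
  · have h1 : s.sup (schwartzSeminormFamily ℝ E ℂ) (SchwartzMap.compSubConstCLM ℂ x φ) ≤
        (1 + ‖x‖) ^ s.sup Prod.fst * s.sup r φ := by
      refine Seminorm.finset_sup_apply_le (by positivity) fun i hi => ?_
      refine SchwartzMap.seminorm_le_bound ℝ i.1 i.2 _ (by positivity) fun t => ?_
      rw [iteratedFDeriv_translate]
      calc ‖t‖ ^ i.1 * ‖iteratedFDeriv ℝ i.2 φ (t - x)‖
          ≤ ((1 + ‖x‖) * (1 + ‖t - x‖)) ^ i.1 * ‖iteratedFDeriv ℝ i.2 φ (t - x)‖ := by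
            gcongr
            linarith [one_add_norm_le_mul_sub t x]
        _ = (1 + ‖x‖) ^ i.1 * ((1 + ‖t - x‖) ^ i.1 * ‖iteratedFDeriv ℝ i.2 φ (t - x)‖) := by
            rw [mul_pow]; ring
        _ ≤ (1 + ‖x‖) ^ i.1 * r i φ := by
            gcongr
            exact hrle i φ _
        _ ≤ _ := by
            gcongr
            · linarith [norm_nonneg x]
            · exact Finset.le_sup (f := Prod.fst) hi
            · exact Seminorm.le_finset_sup_apply hi
    calc q (SchwartzMap.compSubConstCLM ℂ x φ)
        ≤ C * s.sup (schwartzSeminormFamily ℝ E ℂ) (SchwartzMap.compSubConstCLM ℂ x φ) :=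
          hC _
      _ ≤ C * ((1 + ‖x‖) ^ s.sup Prod.fst * s.sup r φ) := by gcongr
      _ = (1 + ‖x‖) ^ s.sup Prod.fst * (C * s.sup r φ) := by ring
      _ = _ := rfl

/-- At the origin, the mean value inequality bounds the `n`-th derivative of the difference by `‖x‖`
times a weighted derivative of order `n + 1`. Translations compose and each is continuous, which
moves the statement to any other base point. -/
theorem continuous_translate (φ : 𝓢(E, ℂ)) :
    Continuous fun x : E => SchwartzMap.compSubConstCLM ℂ x φ := by
  have h0 : Tendsto (fun x : E => SchwartzMap.compSubConstCLM ℂ x φ) (𝓝 0) (𝓝 φ) := by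
    rw [(schwartz_withSeminorms ℝ E ℂ).tendsto_nhds]
    rintro ⟨k, n⟩ ε hε
    obtain ⟨r, -, hr⟩ := exists_seminorm_weighted_deriv_le (E := E) k (n + 1)
    have hbound : ∀ x : E, ‖x‖ ≤ 1 →
        schwartzSeminormFamily ℝ E ℂ (k, n) (SchwartzMap.compSubConstCLM ℂ x φ - φ) ≤
          2 ^ k * r φ * ‖x‖ := by
      intro x hx
      refine SchwartzMap.seminorm_le_bound ℝ k n _ (by positivity) fun t => ?_
      have hsub : iteratedFDeriv ℝ n (SchwartzMap.compSubConstCLM ℂ x φ - φ : 𝓢(E, ℂ)) t =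
          iteratedFDeriv ℝ n φ (t - x) - iteratedFDeriv ℝ n φ t := by
        rw [← iteratedFDeriv_translate]
        exact iteratedFDeriv_sub_apply ((SchwartzMap.smooth _ n).contDiffAt)
          ((φ.smooth n).contDiffAt)
      have hmv : ‖iteratedFDeriv ℝ n φ (t - x) - iteratedFDeriv ℝ n φ t‖ ≤
          (2 ^ k * r φ / (1 + ‖t‖) ^ k) * ‖(t - x) - t‖ := by
        refine (convex_segment t (t - x)).norm_image_sub_le_of_norm_fderiv_le (𝕜 := ℝ)
          (fun s _ => ?_) (fun s hs => ?_) (left_mem_segment ℝ _ _) (right_mem_segment ℝ _ _)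
        · exact ((φ.smooth (n + 1 : ℕ)).differentiable_iteratedFDeriv
            (by exact_mod_cast Nat.lt_succ_self n)) s
        · rw [norm_fderiv_iteratedFDeriv, le_div_iff₀ (by positivity)]
          obtain ⟨θ, hθ, rfl⟩ := (segment_eq_image' ℝ t (t - x)) ▸ hs
          set s := t + θ • (t - x - t) with hs'
          have hts : ‖t - s‖ ≤ 1 := by
            have : t - s = θ • x := by rw [hs']; simp
            rw [this, norm_smul, Real.norm_of_nonneg hθ.1]
            exact mul_le_one₀ hθ.2 (norm_nonneg _) hx
          -- Along a segment of length at most one the weight varies by at most a factor of two, so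
          -- decay at `s` counts as decay at `t`.
          have h2 : 1 + ‖t‖ ≤ 2 * (1 + ‖s‖) := by
            have := one_add_norm_le_mul_sub t s
            nlinarith [norm_nonneg s]
          calc ‖iteratedFDeriv ℝ (n + 1) φ s‖ * (1 + ‖t‖) ^ k
              ≤ ‖iteratedFDeriv ℝ (n + 1) φ s‖ * (2 * (1 + ‖s‖)) ^ k := by gcongr
            _ = 2 ^ k * ((1 + ‖s‖) ^ k * ‖iteratedFDeriv ℝ (n + 1) φ s‖) := by
                rw [mul_pow]; ring
            _ ≤ 2 ^ k * r φ := by gcongr; exact hr φ s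
      rw [hsub]
      calc ‖t‖ ^ k * ‖iteratedFDeriv ℝ n φ (t - x) - iteratedFDeriv ℝ n φ t‖
          ≤ (1 + ‖t‖) ^ k * ((2 ^ k * r φ / (1 + ‖t‖) ^ k) * ‖(t - x) - t‖) := by
            gcongr
            linarith
        _ = 2 ^ k * r φ * ‖x‖ := by
            have : (t - x) - t = -x := by abel
            rw [this, norm_neg, ← mul_assoc, mul_div_cancel₀ _ (by positivity)]
    have hlim : Tendsto (fun x : E => 2 ^ k * r φ * ‖x‖) (𝓝 0) (𝓝 0) := by
      have : Continuous fun x : E => 2 ^ k * r φ * ‖x‖ := by fun_prop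
      simpa using this.tendsto 0
    filter_upwards [hlim.eventually (gt_mem_nhds hε), Metric.ball_mem_nhds (0 : E) one_pos]
      with x hx hx1
    exact (hbound x (by simpa using (mem_ball_zero_iff.mp hx1).le)).trans_lt hx
  rw [continuous_iff_continuousAt]
  intro x₀
  have hcomp : (fun x : E => SchwartzMap.compSubConstCLM ℂ x φ) =
      fun x => SchwartzMap.compSubConstCLM ℂ x₀ (SchwartzMap.compSubConstCLM ℂ (x - x₀) φ) := by
    ext x t
    simp only [SchwartzMap.compSubConstCLM_apply]
    congr 1
    abel
  rw [ContinuousAt, hcomp]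
  refine ((SchwartzMap.compSubConstCLM ℂ x₀).continuous.tendsto _).comp ?_
  have : Tendsto (fun x : E => x - x₀) (𝓝 x₀) (𝓝 0) := by
    simpa using (continuous_id.sub continuous_const).tendsto (f := fun x : E => x - x₀) x₀
  simpa [Function.comp_def] using h0.comp this

end Translation

/-! ### Modulations and the Fourier transform. -/

section Shift

variable {d : ℕ}

theorem tfChar_add_left (ω η t : Sp d) : tfChar (ω + η) t = tfChar ω t * tfChar η t := by
  rw [tfChar, tfChar, tfChar, ← Complex.exp_add, inner_add_left]
  congr 1; push_cast; ring

theorem tfChar_add_right (ω t s : Sp d) : tfChar ω (t + s) = tfChar ω t * tfChar ω s := by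
  rw [tfChar, tfChar, tfChar, ← Complex.exp_add, inner_add_right]
  congr 1; push_cast; ring

theorem tfChar_comm (ω t : Sp d) : tfChar ω t = tfChar t ω := by
  rw [tfChar, tfChar, real_inner_comm]

theorem conj_tfChar (ω t : Sp d) : starRingEnd ℂ (tfChar ω t) = tfChar (-ω) t := by
  rw [tfChar, tfChar, ← Complex.exp_conj, inner_neg_left]
  congr 1
  simp [map_ofNat]

theorem fourier_apply_eq (φ : 𝓢(Sp d, ℂ)) (ω : Sp d) :
    𝓕 φ ω = ∫ t, tfChar (-ω) t * φ t := by
  rw [SchwartzMap.fourier_coe, Real.fourier_eq']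
  refine integral_congr_ae (Eventually.of_forall fun t => ?_)
  simp only [tfChar, smul_eq_mul, inner_neg_left, real_inner_comm]
  congr 2
  push_cast; ring

theorem fourier_modulate (ω : Sp d) (φ : 𝓢(Sp d, ℂ)) :
    𝓕 (SchwartzMap.smulLeftCLM ℂ (tfChar ω) φ) = SchwartzMap.compSubConstCLM ℂ ω (𝓕 φ) := by
  ext η
  rw [SchwartzMap.compSubConstCLM_apply, fourier_apply_eq, fourier_apply_eq]
  refine integral_congr_ae (Eventually.of_forall fun t => ?_)
  simp only [SchwartzMap.smulLeftCLM_apply_apply (hasTemperateGrowth_tfChar ω), smul_eq_mul]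
  rw [← mul_assoc, ← tfChar_add_left]
  congr 2; abel

theorem fourier_translate (x : Sp d) (φ : 𝓢(Sp d, ℂ)) :
    𝓕 (SchwartzMap.compSubConstCLM ℂ x φ) = SchwartzMap.smulLeftCLM ℂ (tfChar (-x)) (𝓕 φ) := by
  ext η
  rw [SchwartzMap.smulLeftCLM_apply_apply (hasTemperateGrowth_tfChar _), fourier_apply_eq,
    fourier_apply_eq, smul_eq_mul, ← integral_const_mul,
    ← integral_sub_right_eq_self (fun t => tfChar (-x) η * (tfChar (-η) t * φ t)) x]
  refine integral_congr_ae (Eventually.of_forall fun t => ?_)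
  simp only [SchwartzMap.compSubConstCLM_apply]
  have : tfChar (-η) t = tfChar (-x) η * tfChar (-η) (t - x) := by
    rw [tfChar_comm (-x) η, show tfChar η (-x) = tfChar (-η) x by
      rw [tfChar, tfChar, inner_neg_left, inner_neg_right], ← tfChar_add_right]
    congr 1; abel
  rw [this, mul_assoc]

/-- Conjugation by the Fourier transform turns every seminorm estimate and continuity statement for
translations into one for modulations. -/
theorem modulate_eq (ω : Sp d) (φ : 𝓢(Sp d, ℂ)) :
    SchwartzMap.smulLeftCLM ℂ (tfChar ω) φ = 𝓕⁻ (SchwartzMap.compSubConstCLM ℂ ω (𝓕 φ)) := by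
  rw [← fourier_modulate, fourierInv_fourier_eq]

end Shift

end GaborQC

namespace GaborQC

open FourierTransform

/-! ### Time-frequency shifts and decay of the transform on Schwartz functions. -/

section ShiftBounds

variable {d : ℕ}

/-- Continuous seminorms of modulated functions grow at most polynomially. -/
theorem exists_seminorm_modulate_le (q : Seminorm ℝ 𝓢(Sp d, ℂ)) (hq : Continuous q) :
    ∃ (k : ℕ) (q' : Seminorm ℝ 𝓢(Sp d, ℂ)), Continuous q' ∧ ∀ (ω : Sp d) (φ : 𝓢(Sp d, ℂ)),
      q (SchwartzMap.smulLeftCLM ℂ (tfChar ω) φ) ≤ (1 + ‖ω‖) ^ k * q' φ := by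
  have hinv : Continuous fun φ : 𝓢(Sp d, ℂ) => (𝓕⁻ φ : 𝓢(Sp d, ℂ)) := (fourierInvCLM ℝ 𝓢(Sp d, ℂ)).continuous
  have hfou : Continuous fun φ : 𝓢(Sp d, ℂ) => (𝓕 φ : 𝓢(Sp d, ℂ)) := (fourierCLM ℝ 𝓢(Sp d, ℂ)).continuous
  obtain ⟨k, q', hq', h⟩ := exists_seminorm_translate_le
    (q.comp (fourierInvCLM ℝ 𝓢(Sp d, ℂ)).toLinearMap) (hq.comp hinv)
  refine ⟨k, q'.comp (fourierCLM ℝ 𝓢(Sp d, ℂ)).toLinearMap, hq'.comp hfou, fun ω φ => ?_⟩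
  rw [modulate_eq]
  exact h ω (𝓕 φ)

theorem continuous_modulate (φ : 𝓢(Sp d, ℂ)) :
    Continuous fun ω : Sp d => SchwartzMap.smulLeftCLM ℂ (tfChar ω) φ := by
  simp_rw [modulate_eq]
  exact (fourierInvCLM ℂ 𝓢(Sp d, ℂ)).continuous.comp (continuous_translate (𝓕 φ))

/-- Continuous seminorms of time-frequency shifts grow at most polynomially. -/
theorem exists_seminorm_shift_le (q : Seminorm ℝ 𝓢(Sp d, ℂ)) (hq : Continuous q) :
    ∃ (k : ℕ) (q' : Seminorm ℝ 𝓢(Sp d, ℂ)), Continuous q' ∧ ∀ (w : TF d) (φ : 𝓢(Sp d, ℂ)),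
      q (shiftSchwartz w φ) ≤ (1 + ‖w‖) ^ k * q' φ := by
  obtain ⟨k₁, q₁, hq₁, h₁⟩ := exists_seminorm_modulate_le q hq
  obtain ⟨k₂, q₂, hq₂, h₂⟩ := exists_seminorm_translate_le q₁ hq₁
  refine ⟨k₁ + k₂, q₂, hq₂, fun w φ => ?_⟩
  calc q (shiftSchwartz w φ)
      ≤ (1 + ‖w.snd‖) ^ k₁ * q₁ (SchwartzMap.compSubConstCLM ℂ w.fst φ) := h₁ _ _
    _ ≤ (1 + ‖w.snd‖) ^ k₁ * ((1 + ‖w.fst‖) ^ k₂ * q₂ φ) := by gcongr; exact h₂ _ _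
    _ ≤ (1 + ‖w‖) ^ k₁ * ((1 + ‖w‖) ^ k₂ * q₂ φ) := by
        gcongr
        · exact WithLp.norm_snd_le _ w
        · exact WithLp.norm_fst_le _ w
    _ = _ := by rw [pow_add]; ring

theorem continuous_shiftSchwartz (φ : 𝓢(Sp d, ℂ)) :
    Continuous fun w : TF d => shiftSchwartz w φ := by
  rw [continuous_iff_continuousAt]
  intro w₀
  rw [ContinuousAt, (schwartz_withSeminorms ℝ (Sp d) ℂ).tendsto_nhds]
  intro i ε hε
  set p := schwartzSeminormFamily ℝ (Sp d) ℂ i with hp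
  have hpc : Continuous p := (schwartz_withSeminorms ℝ (Sp d) ℂ).continuous_seminorm i
  obtain ⟨k, q, hq, h⟩ := exists_seminorm_modulate_le p hpc
  let T : TF d → 𝓢(Sp d, ℂ) := fun w => SchwartzMap.compSubConstCLM ℂ w.fst φ
  have hT : Continuous T := (continuous_translate φ).comp (WithLp.continuous_fst 2 _ _)
  have h1 : Continuous fun w : TF d => (1 + ‖w.snd‖) ^ k * q (T w - T w₀) := by
    have : Continuous fun w : TF d => w.snd := (WithLp.continuous_snd 2 _ _)
    have h2 : Continuous fun w : TF d => q (T w - T w₀) := hq.comp (hT.sub continuous_const)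
    fun_prop
  have h2 : Continuous fun w : TF d =>
      p (SchwartzMap.smulLeftCLM ℂ (tfChar w.snd) (T w₀) -
        SchwartzMap.smulLeftCLM ℂ (tfChar w₀.snd) (T w₀)) :=
    hpc.comp (((continuous_modulate (T w₀)).comp (WithLp.continuous_snd 2 _ _)).sub continuous_const)
  have h3 : Tendsto (fun w : TF d => (1 + ‖w.snd‖) ^ k * q (T w - T w₀) +
      p (SchwartzMap.smulLeftCLM ℂ (tfChar w.snd) (T w₀) -
        SchwartzMap.smulLeftCLM ℂ (tfChar w₀.snd) (T w₀))) (𝓝 w₀) (𝓝 0) := by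
    have h := (h1.add h2).tendsto w₀
    simp only [Pi.add_apply, sub_self, map_zero, mul_zero, add_zero] at h
    exact h
  filter_upwards [h3.eventually (gt_mem_nhds hε)] with w hw
  refine lt_of_le_of_lt ?_ hw
  -- The first term modulates a small function, controlled by the polynomial growth bound; the
  -- second modulates a fixed function.
  have : shiftSchwartz w φ - shiftSchwartz w₀ φ =
      SchwartzMap.smulLeftCLM ℂ (tfChar w.snd) (T w - T w₀) +
      (SchwartzMap.smulLeftCLM ℂ (tfChar w.snd) (T w₀) -
        SchwartzMap.smulLeftCLM ℂ (tfChar w₀.snd) (T w₀)) := by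
    rw [map_sub]; simp [shiftSchwartz, T]
  rw [this]
  exact (map_add_le_add p _ _).trans (add_le_add_left (h _ _) _)

theorem one_add_norm_le_tf (w : TF d) : 1 + ‖w‖ ≤ 2 * max (1 + ‖w.fst‖) (1 + ‖w.snd‖) := by
  have h : ‖w‖ ^ 2 = ‖w.fst‖ ^ 2 + ‖w.snd‖ ^ 2 := WithLp.prod_norm_sq_eq_of_L2 w
  have h1 : ‖w‖ ≤ ‖w.fst‖ + ‖w.snd‖ := by
    refine abs_le_of_sq_le_sq' ?_ (by positivity) |>.2
    nlinarith [mul_nonneg (norm_nonneg w.fst) (norm_nonneg w.snd)]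
  have := le_max_left (1 + ‖w.fst‖) (1 + ‖w.snd‖)
  have := le_max_right (1 + ‖w.fst‖) (1 + ‖w.snd‖)
  linarith

/-- The polynomially decaying weight of order one more than the dimension is integrable. -/
theorem integrable_inv_one_add_norm_pow (E : Type*) [NormedAddCommGroup E] [InnerProductSpace ℝ E]
    [FiniteDimensional ℝ E] [MeasurableSpace E] [BorelSpace E] :
    Integrable fun t : E => ((1 + ‖t‖) ^ (Module.finrank ℝ E + 1))⁻¹ := by
  have := integrable_one_add_norm (E := E) (μ := volume) (r := (Module.finrank ℝ E + 1 : ℕ))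
    (by exact_mod_cast Nat.lt_succ_self _)
  refine this.congr (Eventually.of_forall fun t => ?_)
  simp only
  rw [Real.rpow_neg (by positivity), Real.rpow_natCast]

/-- The weight splits as `1 + ‖x‖ ≤ (1 + ‖t‖)(1 + ‖t - x‖)`, one factor absorbed by `χ` and the
other by `φ`. Extra decay of `χ` of order dimension plus one makes the integral converge. -/
theorem exists_seminorm_translate_decay (φ : 𝓢(Sp d, ℂ)) (M : ℕ) :
    ∃ q : Seminorm ℝ 𝓢(Sp d, ℂ), Continuous q ∧ ∀ (χ : 𝓢(Sp d, ℂ)) (x : Sp d),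
      (1 + ‖x‖) ^ M * ∫ t, ‖χ t‖ * ‖φ (t - x)‖ ≤ q χ := by
  set r := Module.finrank ℝ (Sp d) + 1 with hr
  obtain ⟨q₁, -, h₁⟩ := exists_seminorm_weighted_deriv_le (E := Sp d) M 0
  obtain ⟨q₂, hq₂, h₂⟩ := exists_seminorm_weighted_deriv_le (E := Sp d) (M + r) 0
  simp only [norm_iteratedFDeriv_zero] at h₁ h₂
  set I : ℝ := ∫ t : Sp d, ((1 + ‖t‖) ^ r)⁻¹ with hI
  have hI0 : 0 ≤ I := integral_nonneg fun t => by positivity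
  have hint := integrable_inv_one_add_norm_pow (Sp d)
  rw [← hr] at hint
  refine ⟨(Real.toNNReal (I * q₁ φ)) • q₂, hq₂.const_smul _, fun χ x => ?_⟩
  have hpt : ∀ t, ‖(1 + ‖x‖) ^ M * (‖χ t‖ * ‖φ (t - x)‖)‖ ≤
      q₁ φ * q₂ χ * ((1 + ‖t‖) ^ r)⁻¹ := by
    intro t
    rw [Real.norm_of_nonneg (by positivity)]
    have h3 : 1 + ‖x‖ ≤ (1 + ‖t‖) * (1 + ‖t - x‖) := by
      rw [norm_sub_rev]; exact one_add_norm_le_mul_sub x t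
    have h4 : (1 + ‖t‖) ^ M * ‖χ t‖ ≤ q₂ χ * ((1 + ‖t‖) ^ r)⁻¹ := by
      rw [← div_eq_mul_inv, le_div_iff₀ (by positivity)]
      calc _ = (1 + ‖t‖) ^ (M + r) * ‖χ t‖ := by rw [pow_add]; ring
        _ ≤ _ := h₂ χ t
    calc (1 + ‖x‖) ^ M * (‖χ t‖ * ‖φ (t - x)‖)
        ≤ ((1 + ‖t‖) * (1 + ‖t - x‖)) ^ M * (‖χ t‖ * ‖φ (t - x)‖) := by gcongr
      _ = ((1 + ‖t - x‖) ^ M * ‖φ (t - x)‖) * ((1 + ‖t‖) ^ M * ‖χ t‖) := by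
          rw [mul_pow]; ring
      _ ≤ q₁ φ * (q₂ χ * ((1 + ‖t‖) ^ r)⁻¹) := by
          gcongr
          exact h₁ φ _
      _ = _ := by ring
  rw [← integral_const_mul]
  calc ∫ t, (1 + ‖x‖) ^ M * (‖χ t‖ * ‖φ (t - x)‖)
      ≤ ‖∫ t, (1 + ‖x‖) ^ M * (‖χ t‖ * ‖φ (t - x)‖)‖ := Real.le_norm_self _
    _ ≤ ∫ t, q₁ φ * q₂ χ * ((1 + ‖t‖) ^ r)⁻¹ :=
        norm_integral_le_of_norm_le (hint.const_mul _) (Eventually.of_forall hpt)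
    _ = (Real.toNNReal (I * q₁ φ) : ℝ) * q₂ χ := by
        rw [integral_const_mul, Real.coe_toNNReal _ (by positivity)]; ring
    _ = _ := rfl

/-- The short-time Fourier transform `∫ χ(t) conj((π(w) φ)(t)) dt` of a Schwartz function. -/
def stftS (φ χ : 𝓢(Sp d, ℂ)) (w : TF d) : ℂ :=
  ∫ t, χ t * starRingEnd ℂ (shiftSchwartz w φ t)

theorem norm_shiftSchwartz_apply (w : TF d) (φ : 𝓢(Sp d, ℂ)) (t : Sp d) :
    ‖shiftSchwartz w φ t‖ = ‖φ (t - w.fst)‖ := by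
  rw [shiftSchwartz_apply, shiftFun, norm_mul, norm_tfChar, one_mul]

theorem norm_stftS_le (φ χ : 𝓢(Sp d, ℂ)) (w : TF d) :
    ‖stftS φ χ w‖ ≤ ∫ t, ‖χ t‖ * ‖φ (t - w.fst)‖ := by
  refine (norm_integral_le_integral_norm _).trans (le_of_eq ?_)
  simp [norm_shiftSchwartz_apply]

/-- By Parseval the frequency variable becomes a translation variable on the Fourier side, so decay
in frequency follows from the estimate for decay in time. -/
theorem norm_stftS_le_fourier (φ χ : 𝓢(Sp d, ℂ)) (w : TF d) :
    ‖stftS φ χ w‖ ≤ ∫ t, ‖(𝓕 χ) t‖ * ‖(𝓕 φ) (t - w.snd)‖ := by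
  have h1 : stftS φ χ w = ∫ t, (𝓕 χ) t * starRingEnd ℂ ((𝓕 (shiftSchwartz w φ)) t) := by
    have := SchwartzMap.integral_inner_fourier_fourier (shiftSchwartz w φ) χ
    simp only [RCLike.inner_apply] at this
    exact this.symm
  rw [h1]
  refine (norm_integral_le_integral_norm _).trans (le_of_eq ?_)
  refine integral_congr_ae (Eventually.of_forall fun t => ?_)
  simp only [norm_mul, RCLike.norm_conj]
  rw [shiftSchwartz, fourier_modulate, fourier_translate, SchwartzMap.compSubConstCLM_apply,
    SchwartzMap.smulLeftCLM_apply_apply (hasTemperateGrowth_tfChar _), norm_smul, norm_tfChar,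
    one_mul]

/-- The short-time Fourier transform of a Schwartz function decays rapidly. -/
theorem exists_seminorm_stftS_decay (φ : 𝓢(Sp d, ℂ)) (M : ℕ) :
    ∃ q : Seminorm ℝ 𝓢(Sp d, ℂ), Continuous q ∧ ∀ (χ : 𝓢(Sp d, ℂ)) (w : TF d),
      (1 + ‖w‖) ^ M * ‖stftS φ χ w‖ ≤ q χ := by
  obtain ⟨q₁, hq₁, h₁⟩ := exists_seminorm_translate_decay φ M
  obtain ⟨q₂, hq₂, h₂⟩ := exists_seminorm_translate_decay (𝓕 φ) M
  have hfou : Continuous fun φ : 𝓢(Sp d, ℂ) => (𝓕 φ : 𝓢(Sp d, ℂ)) :=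
    (fourierCLM ℝ 𝓢(Sp d, ℂ)).continuous
  refine ⟨((2 : NNReal) ^ M) • (q₁ + q₂.comp (fourierCLM ℝ 𝓢(Sp d, ℂ)).toLinearMap),
    (hq₁.add (hq₂.comp hfou)).const_smul ((2 : NNReal) ^ M), fun χ w => ?_⟩
  have hb₁ := h₁ χ w.fst
  have hb₂ := h₂ (𝓕 χ) w.snd
  have hle : (1 + ‖w‖) ^ M ≤ 2 ^ M * ((1 + ‖w.fst‖) ^ M + (1 + ‖w.snd‖) ^ M) := by
    calc (1 + ‖w‖) ^ M ≤ (2 * max (1 + ‖w.fst‖) (1 + ‖w.snd‖)) ^ M := by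
          gcongr; exact one_add_norm_le_tf w
      _ = 2 ^ M * (max (1 + ‖w.fst‖) (1 + ‖w.snd‖)) ^ M := mul_pow _ _ _
      _ ≤ _ := by
          gcongr
          rcases max_choice (1 + ‖w.fst‖) (1 + ‖w.snd‖) with h | h <;> rw [h]
          · linarith [show 0 ≤ (1 + ‖w.snd‖) ^ M by positivity]
          · linarith [show 0 ≤ (1 + ‖w.fst‖) ^ M by positivity]
  calc (1 + ‖w‖) ^ M * ‖stftS φ χ w‖
      ≤ 2 ^ M * ((1 + ‖w.fst‖) ^ M + (1 + ‖w.snd‖) ^ M) * ‖stftS φ χ w‖ := by gcongr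
    _ = 2 ^ M * ((1 + ‖w.fst‖) ^ M * ‖stftS φ χ w‖ + (1 + ‖w.snd‖) ^ M * ‖stftS φ χ w‖) := by ring
    _ ≤ 2 ^ M * (q₁ χ + q₂ (𝓕 χ)) := by
        gcongr
        · exact le_trans (by gcongr; exact norm_stftS_le φ χ w) hb₁
        · exact le_trans (by gcongr; exact norm_stftS_le_fourier φ χ w) hb₂
    _ = _ := rfl

/-- Covariance of the short-time Fourier transform. -/
theorem norm_stftS_shift (φ h : 𝓢(Sp d, ℂ)) (z w : TF d) :
    ‖stftS φ (shiftSchwartz z h) w‖ = ‖stftS φ h (w - z)‖ := by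
  have : stftS φ (shiftSchwartz z h) w =
      tfChar z.snd z.fst * starRingEnd ℂ (tfChar w.snd z.fst) * stftS φ h (w - z) := by
    rw [stftS, stftS, ← integral_add_right_eq_self _ z.fst, ← integral_const_mul]
    refine integral_congr_ae (Eventually.of_forall fun t => ?_)
    simp only [shiftSchwartz_apply, shiftFun, map_mul, WithLp.sub_fst, WithLp.sub_snd,
      conj_tfChar, neg_sub, add_sub_cancel_right]
    rw [show t + z.fst - w.fst = t - (w.fst - z.fst) by abel, sub_eq_add_neg z.snd w.snd]
    simp only [tfChar_add_left, tfChar_add_right]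
    ring
  rw [this, norm_mul, norm_mul, RCLike.norm_conj, norm_tfChar, norm_tfChar, one_mul, one_mul]

theorem shiftFun_shiftFun (z u : TF d) (f : Sp d → ℂ) :
    shiftFun z (shiftFun u f) = fun t => tfChar (-u.snd) z.fst * shiftFun (z + u) f t := by
  ext t
  simp only [shiftFun, WithLp.add_fst, WithLp.add_snd]
  rw [sub_sub, tfChar_add_left, sub_eq_add_neg t, tfChar_add_right,
    show tfChar u.snd (-z.fst) = tfChar (-u.snd) z.fst by
      rw [tfChar, tfChar, inner_neg_left, inner_neg_right]]
  ring

theorem shiftSchwartz_shiftSchwartz (z u : TF d) (φ : 𝓢(Sp d, ℂ)) :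
    shiftSchwartz z (shiftSchwartz u φ) =
      tfChar (-u.snd) z.fst • shiftSchwartz (z + u) φ := by
  ext t
  have h : (shiftSchwartz u φ : Sp d → ℂ) = shiftFun u φ := funext (shiftSchwartz_apply u φ)
  rw [shiftSchwartz_apply, h, shiftFun_shiftFun, smul_apply, shiftSchwartz_apply,
    smul_eq_mul]

end ShiftBounds

end GaborQC

namespace GaborQC

open FourierTransform

/-! ### Interchanging a tempered distribution with an integral of Schwartz functions. -/

section WeakIntegral

open scoped BoundedContinuousFunction

variable {E : Type*} [NormedAddCommGroup E] [NormedSpace ℝ E]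

/-- The space of `n`-linear forms, with the instances coming from a single norm structure. -/
def MultForm (E : Type*) [NormedAddCommGroup E] [NormedSpace ℝ E] (n : ℕ) : Type _ :=
  E [×n]→L[ℝ] ℂ

instance (n : ℕ) : NormedAddCommGroup (MultForm E n) :=
  inferInstanceAs (NormedAddCommGroup (E [×n]→L[ℝ] ℂ))

instance (n : ℕ) : NormedSpace ℂ (MultForm E n) :=
  inferInstanceAs (NormedSpace ℂ (E [×n]→L[ℝ] ℂ))

instance (n : ℕ) : CompleteSpace (MultForm E n) :=
  inferInstanceAs (CompleteSpace (E [×n]→L[ℝ] ℂ))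

/-- The `n`-th derivative of a Schwartz function as a form-valued function. -/
def formDeriv (n : ℕ) (φ : 𝓢(E, ℂ)) (t : E) : MultForm E n := iteratedFDeriv ℝ n φ t

theorem norm_formDeriv (n : ℕ) (φ : 𝓢(E, ℂ)) (t : E) :
    ‖formDeriv n φ t‖ = ‖iteratedFDeriv ℝ n φ t‖ := rfl

theorem continuous_formDeriv (n : ℕ) (φ : 𝓢(E, ℂ)) : Continuous (formDeriv n φ) :=
  (φ.smooth n).continuous_iteratedFDeriv le_rfl

/-- The weighted derivative `t ↦ ‖t‖ᵏ Dⁿφ(t)` of a Schwartz function, as a bounded function. -/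
def weightedDerivBCF (k n : ℕ) (φ : 𝓢(E, ℂ)) : E →ᵇ MultForm E n :=
  BoundedContinuousFunction.ofNormedAddCommGroup
    (fun t : E => ((‖t‖ ^ k : ℝ) : ℂ) • formDeriv n φ t)
    ((Complex.continuous_ofReal.comp (continuous_norm.pow k)).smul (continuous_formDeriv n φ))
    (SchwartzMap.seminorm ℝ k n φ)
    (fun t => by
      rw [norm_smul, Complex.norm_real, Real.norm_of_nonneg (by positivity)]
      exact SchwartzMap.le_seminorm ℝ k n φ t)

theorem norm_weightedDerivBCF_le (k n : ℕ) (φ : 𝓢(E, ℂ)) :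
    ‖weightedDerivBCF k n φ‖ ≤ SchwartzMap.seminorm ℂ k n φ :=
  BoundedContinuousFunction.norm_ofNormedAddCommGroup_le _ (apply_nonneg _ _) _

theorem formDeriv_add (n : ℕ) (φ ψ : 𝓢(E, ℂ)) (t : E) :
    formDeriv n (φ + ψ) t = formDeriv n φ t + formDeriv n ψ t :=
  iteratedFDeriv_add_apply (φ.smooth n).contDiffAt (ψ.smooth n).contDiffAt

theorem formDeriv_smul (n : ℕ) (c : ℂ) (φ : 𝓢(E, ℂ)) (t : E) :
    formDeriv n (c • φ) t = c • formDeriv n φ t :=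
  iteratedFDeriv_const_smul_apply (φ.smooth n).contDiffAt

/-- The weighted derivative as a continuous linear map into bounded continuous functions. -/
def weightedDeriv (k n : ℕ) : 𝓢(E, ℂ) →L[ℂ] E →ᵇ MultForm E n :=
  SchwartzMap.mkCLMtoNormedSpace (σ := RingHom.id ℂ) (fun φ : 𝓢(E, ℂ) => weightedDerivBCF k n φ)
    (fun φ ψ => by
      ext1 t
      change ((‖t‖ ^ k : ℝ) : ℂ) • formDeriv n (φ + ψ) t = _
      rw [formDeriv_add, smul_add]
      rfl)
    (fun c φ => by
      ext1 t
      change ((‖t‖ ^ k : ℝ) : ℂ) • formDeriv n (c • φ) t = _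
      rw [formDeriv_smul, smul_comm]
      rfl)
    ⟨{(k, n)}, 1, zero_le_one, fun φ => by
      rw [Finset.sup_singleton, one_mul]
      exact norm_weightedDerivBCF_le k n φ⟩

theorem weightedDeriv_apply (k n : ℕ) (φ : 𝓢(E, ℂ)) (t : E) :
    weightedDeriv k n φ t = ((‖t‖ ^ k : ℝ) : ℂ) • formDeriv n φ t := rfl

theorem norm_weightedDeriv_le (k n : ℕ) (φ : 𝓢(E, ℂ)) :
    ‖weightedDeriv k n φ‖ ≤ SchwartzMap.seminorm ℂ k n φ :=
  norm_weightedDerivBCF_le k n φ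

theorem seminorm_le_norm_weightedDeriv (k n : ℕ) (φ : 𝓢(E, ℂ)) :
    SchwartzMap.seminorm ℂ k n φ ≤ ‖weightedDeriv k n φ‖ := by
  refine SchwartzMap.seminorm_le_bound ℂ k n φ (norm_nonneg (weightedDeriv k n φ)) fun t => ?_
  refine le_trans (le_of_eq ?_) ((weightedDeriv k n φ).norm_coe_le_norm t)
  rw [weightedDeriv_apply, norm_smul, Complex.norm_real, Real.norm_of_nonneg (by positivity),
    norm_formDeriv]

theorem continuous_formDeriv_apply (n : ℕ) (t : E) :
    Continuous fun φ : 𝓢(E, ℂ) => formDeriv n φ t := by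
  have h : (fun φ : 𝓢(E, ℂ) => formDeriv n φ t) =
      fun φ => BoundedContinuousFunction.evalCLM ℂ t (weightedDeriv 0 n φ) := by
    ext1 φ
    rw [BoundedContinuousFunction.evalCLM_apply, weightedDeriv_apply, pow_zero,
      Complex.ofReal_one, one_smul]
  rw [h]
  exact (BoundedContinuousFunction.evalCLM ℂ t).continuous.comp (weightedDeriv 0 n).continuous

theorem continuous_iteratedFDeriv_apply (n : ℕ) (t : E) :
    Continuous fun φ : 𝓢(E, ℂ) => iteratedFDeriv ℝ n φ t :=
  continuous_formDeriv_apply n t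

variable {W : Type*} [TopologicalSpace W] [MeasurableSpace W] [OpensMeasurableSpace W]
  [SecondCountableTopology W] {μ : Measure W}

/-- Derivatives commute with the integral of a family of Schwartz functions whose seminorms are
integrable. -/
theorem iteratedFDeriv_integral_schwartz {G : W → 𝓢(E, ℂ)} (hG : Continuous G)
    (hint : ∀ k n, Integrable (fun w => SchwartzMap.seminorm ℂ k n (G w)) μ) (n : ℕ) :
    iteratedFDeriv ℝ n (fun t => ∫ w, G w t ∂μ) = fun t => ∫ w, iteratedFDeriv ℝ n (G w) t ∂μ := by
  have hmeas : ∀ n t, AEStronglyMeasurable (fun w => iteratedFDeriv ℝ n (G w) t) μ := fun n t =>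
    ((continuous_iteratedFDeriv_apply n t).comp hG).aestronglyMeasurable
  have hbd : ∀ n w t, ‖iteratedFDeriv ℝ n (G w) t‖ ≤ SchwartzMap.seminorm ℂ 0 n (G w) :=
    fun n w t => SchwartzMap.norm_iteratedFDeriv_le_seminorm ℂ (G w) n t
  induction n with
  | zero =>
    ext1 t
    simp only [iteratedFDeriv_zero_eq_comp, Function.comp_apply]
    exact ((continuousMultilinearCurryFin0 ℝ E ℂ).symm.toContinuousLinearEquiv.integral_comp_comm
      (fun w => G w t)).symm
  | succ n ih =>
    let L := continuousMultilinearCurryLeftEquiv ℝ (fun _ : Fin (n + 1) => E) ℂ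
    have hL : ∀ w t, fderiv ℝ (iteratedFDeriv ℝ n (G w)) t = L (iteratedFDeriv ℝ (n + 1) (G w) t) := by
      intro w t
      rw [iteratedFDeriv_succ_eq_comp_left, Function.comp_apply, LinearIsometryEquiv.apply_symm_apply]
    ext1 t
    have hd : HasFDerivAt (fun t => ∫ w, iteratedFDeriv ℝ n (G w) t ∂μ)
        (∫ w, fderiv ℝ (iteratedFDeriv ℝ n (G w)) t ∂μ) t := by
      refine hasFDerivAt_integral_of_dominated_of_fderiv_le (𝕜 := ℝ) (s := univ)
        (F := fun s w => iteratedFDeriv ℝ n (G w) s)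
        (F' := fun s w => fderiv ℝ (iteratedFDeriv ℝ n (G w)) s)
        (bound := fun w => SchwartzMap.seminorm ℂ 0 (n + 1) (G w)) univ_mem
        (Eventually.of_forall fun s => hmeas n s) ?_ ?_ ?_ (hint 0 (n + 1)) ?_
      · exact (hint 0 n).mono' (hmeas n t) (Eventually.of_forall fun w => hbd n w t)
      · simp_rw [hL]
        exact L.continuous.comp_aestronglyMeasurable (hmeas (n + 1) t)
      · refine Eventually.of_forall fun w s _ => ?_
        rw [norm_fderiv_iteratedFDeriv]
        exact hbd (n + 1) w s
      · refine Eventually.of_forall fun w s _ => ?_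
        exact ((((G w).smooth (n + 1 : ℕ)).differentiable_iteratedFDeriv
            (by exact_mod_cast Nat.lt_succ_self n)) s).hasFDerivAt
    rw [iteratedFDeriv_succ_eq_comp_left, Function.comp_apply, ih, hd.fderiv]
    exact (ContinuousLinearEquiv.integral_comp_comm (𝕜 := ℝ) (E := E →L[ℝ] E [×n]→L[ℝ] ℂ)
      (F := E [×(n + 1)]→L[ℝ] ℂ) L.symm.toContinuousLinearEquiv
      (fun w => fderiv ℝ (iteratedFDeriv ℝ n (G w)) t)).symm

/-- A functional bounded by the norm of a linear map `J` into a normed space factors through `J`. -/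
theorem exists_dual_factor {S X : Type*} [AddCommGroup S] [Module ℂ S] [NormedAddCommGroup X]
    [NormedSpace ℂ X] (J : S →ₗ[ℂ] X) (f : S →ₗ[ℂ] ℂ) {C : ℝ} (h : ∀ φ, ‖f φ‖ ≤ C * ‖J φ‖) :
    ∃ g : StrongDual ℂ X, ∀ φ, g (J φ) = f φ := by
  obtain ⟨σ, hσ⟩ := J.rangeRestrict.exists_rightInverse_of_surjective J.range_rangeRestrict
  have hJσ : ∀ x, J (σ x) = x := fun x => congr_arg Subtype.val (LinearMap.congr_fun hσ x)
  let g₀ : StrongDual ℂ (LinearMap.range J) := (f ∘ₗ σ).mkContinuous C fun x => by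
    have := h (σ x)
    rwa [hJσ] at this
  obtain ⟨g, hg, -⟩ := exists_extension_norm_eq _ g₀
  refine ⟨g, fun φ => ?_⟩
  have h1 : g (J φ) = f (σ (J.rangeRestrict φ)) := hg (J.rangeRestrict φ)
  -- This argument lies in the kernel of `J`, so the bound forces `f` to vanish on it and the choice
  -- of section is irrelevant.
  have h2 := h (σ (J.rangeRestrict φ) - φ)
  rw [map_sub, map_sub, hJσ] at h2
  rw [h1, ← sub_eq_zero, ← norm_le_zero_iff]
  simpa using h2

/-- A functional bounded by finitely many norms `‖J i φ‖` commutes with integrals that are computed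
by all of the maps `J i`. -/
theorem apply_integral_of_bound {S ι Y : Type*} [AddCommGroup S] [Module ℂ S] [Fintype ι]
    {X : ι → Type*} [∀ i, NormedAddCommGroup (X i)] [∀ i, NormedSpace ℂ (X i)]
    [∀ i, CompleteSpace (X i)] (J : ∀ i, S →ₗ[ℂ] X i) (f : S →ₗ[ℂ] ℂ) {C : ℝ}
    (h : ∀ φ, ∀ B, 0 ≤ B → (∀ i, ‖J i φ‖ ≤ B) → ‖f φ‖ ≤ C * B) [MeasurableSpace Y]
    {ν : Measure Y} {G : Y → S} (hint : ∀ i, Integrable (fun w => J i (G w)) ν) {Ψ : S}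
    (hΨ : ∀ i, J i Ψ = ∫ w, J i (G w) ∂ν) :
    f Ψ = ∫ w, f (G w) ∂ν := by
  obtain ⟨g, hg⟩ := exists_dual_factor (LinearMap.pi J) f
    (fun φ => h φ _ (norm_nonneg _) fun i => norm_le_pi_norm (LinearMap.pi J φ) i)
  have hJint : Integrable (fun w => LinearMap.pi J (G w)) ν := Integrable.of_eval hint
  have hJΨ : LinearMap.pi J Ψ = ∫ w, LinearMap.pi J (G w) ∂ν := by
    ext1 i
    rw [eval_integral fun i => hJint.eval i]
    exact hΨ i
  rw [← hg, hJΨ, ← ContinuousLinearMap.integral_comp_comm _ hJint]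
  simp_rw [hg]

/-- A tempered distribution commutes with the integral of a family of Schwartz functions whose
seminorms are integrable. -/
theorem tempered_apply_integral (f : 𝓢'(E, ℂ)) {G : W → 𝓢(E, ℂ)} (hG : Continuous G)
    (hint : ∀ k n, Integrable (fun w => SchwartzMap.seminorm ℂ k n (G w)) μ) {Ψ : 𝓢(E, ℂ)}
    (hΨ : ∀ t, Ψ t = ∫ w, G w t ∂μ) :
    f Ψ = ∫ w, f (G w) ∂μ := by
  -- Continuity involves only finitely many seminorms, each the sup norm of a weighted derivative.
  -- Thus `f` factors through a finite product of Banach spaces, where Bochner integrals commute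
  -- with functionals.
  obtain ⟨s, C, -, hC⟩ := Seminorm.bound_of_continuous (schwartz_withSeminorms ℂ E ℂ)
    ((normSeminorm ℂ ℂ).comp f.toLinearMap) (continuous_norm.comp (map_continuous f))
  have hJint : ∀ k n, Integrable (fun w => weightedDeriv k n (G w)) μ := fun k n =>
    (hint k n).mono' ((weightedDeriv k n).continuous.comp hG).aestronglyMeasurable
      (Eventually.of_forall fun w => norm_weightedDeriv_le _ _ _)
  refine apply_integral_of_bound (S := 𝓢(E, ℂ)) (ι := s)
    (X := fun i => E →ᵇ MultForm E i.1.2)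
    (fun i => (weightedDeriv i.1.1 i.1.2 : 𝓢(E, ℂ) →L[ℂ] _).toLinearMap) f.toLinearMap
    (C := C) (fun φ B hB hφ => ?_) (fun i => hJint _ _) (fun i => ?_)
  · refine (hC φ).trans ?_
    change (C : ℝ) * s.sup (schwartzSeminormFamily ℂ E ℂ) φ ≤ _
    refine mul_le_mul_of_nonneg_left ?_ C.2
    exact Seminorm.finset_sup_apply_le hB fun i hi =>
      (seminorm_le_norm_weightedDeriv i.1 i.2 φ).trans (hφ ⟨i, hi⟩)
  · change weightedDeriv i.1.1 i.1.2 Ψ = ∫ w, weightedDeriv i.1.1 i.1.2 (G w) ∂μ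
    ext1 t
    rw [← BoundedContinuousFunction.evalCLM_apply ℂ t (∫ w, weightedDeriv i.1.1 i.1.2 (G w) ∂μ),
      ← ContinuousLinearMap.integral_comp_comm _ (hJint _ _)]
    simp only [BoundedContinuousFunction.evalCLM_apply, weightedDeriv_apply]
    rw [integral_smul]
    congr 1
    refine Eq.trans ?_ (congr_fun (iteratedFDeriv_integral_schwartz hG hint i.1.2) t)
    rw [formDeriv, show (Ψ : E → ℂ) = fun t => ∫ w, G w t ∂μ from funext hΨ]

end WeakIntegral

end GaborQC

namespace GaborQC

open FourierTransform

/-! ### Inversion and the reproducing formula. -/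

section Reproducing

variable {d : ℕ}

theorem continuous_conjSchwartz : Continuous (conjSchwartz : 𝓢(Sp d, ℂ) → 𝓢(Sp d, ℂ)) :=
  (SchwartzMap.postcompCLM (𝕜 := ℝ) (Complex.conjCLE : ℂ →L[ℝ] ℂ)).continuous

theorem conjSchwartz_conjSchwartz (ψ : 𝓢(Sp d, ℂ)) : conjSchwartz (conjSchwartz ψ) = ψ := by
  ext t
  simp [conjSchwartz_apply]

/-- The adjoint transform `∫ (π(w) φ)(s) ψ(s) ds`, the complex conjugate of the short-time Fourier
transform of the conjugate of `ψ`. -/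
def stftConj (φ ψ : 𝓢(Sp d, ℂ)) (w : TF d) : ℂ := ∫ s, shiftSchwartz w φ s * ψ s

theorem stftConj_eq (φ ψ : 𝓢(Sp d, ℂ)) (w : TF d) :
    stftConj φ ψ w = starRingEnd ℂ (stftS φ (conjSchwartz ψ) w) := by
  rw [stftConj, stftS, ← integral_conj]
  refine integral_congr_ae (Eventually.of_forall fun s => ?_)
  simp [conjSchwartz_apply, mul_comm]

theorem norm_stftConj (φ ψ : 𝓢(Sp d, ℂ)) (w : TF d) :
    ‖stftConj φ ψ w‖ = ‖stftS φ (conjSchwartz ψ) w‖ := by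
  rw [stftConj_eq, RCLike.norm_conj]

theorem continuous_stftConj (φ ψ : 𝓢(Sp d, ℂ)) : Continuous (stftConj φ ψ) := by
  have h : stftConj φ ψ = fun w =>
      SchwartzMap.toTemperedDistributionCLM (Sp d) ℂ volume ψ (shiftSchwartz w φ) := by
    ext1 w
    exact (SchwartzMap.toTemperedDistributionCLM_apply_apply volume ψ _).symm
  rw [h]
  exact (map_continuous _).comp (continuous_shiftSchwartz φ)

theorem continuous_stft (φ : 𝓢(Sp d, ℂ)) (f : 𝓢'(Sp d, ℂ)) : Continuous (stft φ f) :=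
  (map_continuous f).comp (continuous_conjSchwartz.comp (continuous_shiftSchwartz φ))

theorem integrable_seminorm_stftConj_smul (φ ψ : 𝓢(Sp d, ℂ)) (k n : ℕ) :
    Integrable fun w : TF d => SchwartzMap.seminorm ℂ k n
      (stftConj φ ψ w • conjSchwartz (shiftSchwartz w φ)) := by
  let p := schwartzSeminormFamily ℝ (Sp d) ℂ (k, n)
  have hp : Continuous p := (schwartz_withSeminorms ℝ (Sp d) ℂ).continuous_seminorm (k, n)
  let q := p.comp (SchwartzMap.postcompCLM (𝕜 := ℝ) (E := Sp d)
    (Complex.conjCLE : ℂ →L[ℝ] ℂ)).toLinearMap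
  have hq : Continuous q := hp.comp continuous_conjSchwartz
  obtain ⟨m, q', -, hq'⟩ := exists_seminorm_shift_le q hq
  set r := Module.finrank ℝ (TF d) + 1 with hr
  -- The power `m` cancels the growth of the shifted seminorm and `r` leaves an integrable weight.
  obtain ⟨p', -, hp'⟩ := exists_seminorm_stftS_decay φ (m + r)
  have hint := integrable_inv_one_add_norm_pow (TF d)
  rw [← hr] at hint
  have hcont : Continuous fun w : TF d => stftConj φ ψ w • conjSchwartz (shiftSchwartz w φ) :=
    (continuous_stftConj φ ψ).smul (continuous_conjSchwartz.comp (continuous_shiftSchwartz φ))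
  refine (hint.const_mul (p' (conjSchwartz ψ) * q' φ)).mono' (hp.comp hcont).aestronglyMeasurable
    (Eventually.of_forall fun w => ?_)
  rw [Real.norm_of_nonneg (apply_nonneg _ _), map_smul_eq_mul, norm_stftConj]
  have h1 : SchwartzMap.seminorm ℂ k n (conjSchwartz (shiftSchwartz w φ)) ≤
      (1 + ‖w‖) ^ m * q' φ := hq' w φ
  have h2 := hp' (conjSchwartz ψ) w
  calc ‖stftS φ (conjSchwartz ψ) w‖ *
        SchwartzMap.seminorm ℂ k n (conjSchwartz (shiftSchwartz w φ))
      ≤ ‖stftS φ (conjSchwartz ψ) w‖ * ((1 + ‖w‖) ^ m * q' φ) := by gcongr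
    _ = ((1 + ‖w‖) ^ (m + r) * ‖stftS φ (conjSchwartz ψ) w‖) * q' φ * ((1 + ‖w‖) ^ r)⁻¹ := by
        rw [pow_add]
        field_simp
    _ ≤ _ := by gcongr

/-- Integration over the time-frequency plane as an iterated integral. -/
theorem integral_tf (F : TF d → ℂ) (hF : Integrable F) :
    ∫ w, F w = ∫ x : Sp d, ∫ ω : Sp d, F (WithLp.toLp 2 (x, ω)) := by
  have hmp := WithLp.volume_preserving_toLp (Sp d) (Sp d)
  have hemb : MeasurableEmbedding (WithLp.toLp 2 : Sp d × Sp d → TF d) :=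
    (MeasurableEquiv.toLp 2 (Sp d × Sp d)).measurableEmbedding
  rw [← hmp.integral_comp hemb, Measure.volume_eq_prod]
  exact integral_prod (fun p : Sp d × Sp d => F (WithLp.toLp 2 p))
    (hmp.integrable_comp_of_integrable hF)

theorem integral_normSq_ofReal (φ : 𝓢(Sp d, ℂ)) :
    ((∫ t, ‖φ t‖ ^ 2 : ℝ) : ℂ) = ∫ t, starRingEnd ℂ (φ t) * φ t := by
  rw [← integral_complex_ofReal]
  refine integral_congr_ae (Eventually.of_forall fun t => ?_)
  simp only
  rw [mul_comm, Complex.mul_conj, Complex.normSq_eq_norm_sq]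

/-- Pointwise inversion of the short-time Fourier transform of a Schwartz function. -/
theorem integral_stftConj_smul_apply (φ ψ : 𝓢(Sp d, ℂ)) (t : Sp d) :
    ∫ w : TF d, (stftConj φ ψ w • conjSchwartz (shiftSchwartz w φ)) t =
      ((∫ t, ‖φ t‖ ^ 2 : ℝ) : ℂ) * ψ t := by
  have hcont : Continuous fun w : TF d => stftConj φ ψ w • conjSchwartz (shiftSchwartz w φ) :=
    (continuous_stftConj φ ψ).smul (continuous_conjSchwartz.comp (continuous_shiftSchwartz φ))
  have hev : Continuous fun χ : 𝓢(Sp d, ℂ) => χ t := by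
    have : (fun χ : 𝓢(Sp d, ℂ) => χ t) =
        fun χ => SchwartzMap.toBoundedContinuousFunctionCLM ℂ (Sp d) ℂ χ t := rfl
    rw [this]
    exact (BoundedContinuousFunction.evalCLM ℂ t).continuous.comp
      (SchwartzMap.toBoundedContinuousFunctionCLM ℂ (Sp d) ℂ).continuous
  have hint : Integrable fun w : TF d =>
      (stftConj φ ψ w • conjSchwartz (shiftSchwartz w φ)) t :=
    (integrable_seminorm_stftConj_smul φ ψ 0 0).mono' (hev.comp hcont).aestronglyMeasurable
      (Eventually.of_forall fun w => SchwartzMap.norm_le_seminorm ℂ _ t)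
  rw [integral_tf _ hint, integral_normSq_ofReal, ← integral_mul_const,
    
    ← integral_sub_left_eq_self (fun x => starRingEnd ℂ (φ x) * φ x * ψ t) volume t]
  refine integral_congr_ae (Eventually.of_forall fun x => ?_)
  simp only
  -- For fixed `x` the transform in `ω` is the inverse Fourier transform of `h`, so the `ω`-integral
  -- is Fourier inversion at `t`. The remaining integral over `x` yields `‖φ‖₂²`.
  let h : 𝓢(Sp d, ℂ) := SchwartzMap.smulLeftCLM ℂ ψ (SchwartzMap.compSubConstCLM ℂ x φ)
  have hh : ∀ s, h s = ψ s * φ (s - x) := fun s => by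
    simp [h, SchwartzMap.smulLeftCLM_apply_apply ψ.hasTemperateGrowth]
  have h1 : ∀ ω : Sp d, stftConj φ ψ (WithLp.toLp 2 (x, ω)) = 𝓕⁻ h ω := by
    intro ω
    rw [SchwartzMap.fourierInv_coe, Real.fourierInv_eq', stftConj]
    refine integral_congr_ae (Eventually.of_forall fun s => ?_)
    simp only [shiftSchwartz_apply, shiftFun, hh, tfChar, smul_eq_mul]
    rw [real_inner_comm]
    push_cast
    change Complex.exp (2 * (Real.pi : ℂ) * Complex.I * (⟪s, ω⟫_ℝ : ℝ)) * φ (s - x) * ψ s = _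
    rw [show 2 * (Real.pi : ℂ) * Complex.I * (⟪s, ω⟫_ℝ : ℝ) =
      2 * Real.pi * (⟪s, ω⟫_ℝ : ℝ) * Complex.I by ring]
    ring
  calc ∫ ω : Sp d, (stftConj φ ψ (WithLp.toLp 2 (x, ω)) •
        conjSchwartz (shiftSchwartz (WithLp.toLp 2 (x, ω)) φ)) t
      = ∫ ω : Sp d, starRingEnd ℂ (φ (t - x)) * (tfChar (-t) ω * 𝓕⁻ h ω) := by
        refine integral_congr_ae (Eventually.of_forall fun ω => ?_)
        simp only [smul_apply, smul_eq_mul, conjSchwartz_apply, shiftSchwartz_apply,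
          shiftFun, map_mul, h1, conj_tfChar]
        rw [show tfChar (-t) ω = tfChar (-ω) t by
          rw [tfChar, tfChar, inner_neg_left, inner_neg_left, real_inner_comm]]
        change _ * (tfChar (-ω) t * starRingEnd ℂ (φ (t - x))) = _
        ring
    _ = starRingEnd ℂ (φ (t - x)) * h t := by
        rw [integral_const_mul, ← fourier_apply_eq, fourier_fourierInv_eq]
    _ = _ := by rw [hh]; ring

/-- The reproducing formula for the short-time Fourier transform of a tempered distribution. -/
theorem integral_stft_mul_stftConj (φ ψ : 𝓢(Sp d, ℂ)) (f : 𝓢'(Sp d, ℂ)) :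
    ∫ w : TF d, stft φ f w * stftConj φ ψ w = ((∫ t, ‖φ t‖ ^ 2 : ℝ) : ℂ) * f ψ := by
  have hcont : Continuous fun w : TF d => stftConj φ ψ w • conjSchwartz (shiftSchwartz w φ) :=
    (continuous_stftConj φ ψ).smul (continuous_conjSchwartz.comp (continuous_shiftSchwartz φ))
  have h := tempered_apply_integral f hcont (integrable_seminorm_stftConj_smul φ ψ)
    (Ψ := ((∫ t, ‖φ t‖ ^ 2 : ℝ) : ℂ) • ψ) (fun t => by
      rw [integral_stftConj_smul_apply, smul_apply, smul_eq_mul])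
  rw [map_smul, smul_eq_mul] at h
  rw [h]
  refine integral_congr_ae (Eventually.of_forall fun w => ?_)
  simp only [map_smul, smul_eq_mul]
  rw [mul_comm, stft]

theorem integral_normSq_pos {φ : 𝓢(Sp d, ℂ)} (hφ : φ ≠ 0) : 0 < ∫ t, ‖φ t‖ ^ 2 := by
  obtain ⟨t, ht⟩ : ∃ t, φ t ≠ 0 := by
    by_contra! h
    exact hφ (SchwartzMap.ext h)
  have hint : Integrable fun t => ‖φ t‖ ^ 2 := (φ.memLp 2).integrable_norm_pow (by norm_num)
  exact integral_pos_of_integrable_nonneg_nonzero (x := t) (φ.continuous.norm.pow 2) hint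
    (fun t => by positivity) (by positivity)

end Reproducing

end GaborQC

namespace GaborQC

/-! ### The oscillation estimate for the short-time Fourier transform. -/

section Oscillation

variable {d : ℕ}

theorem conjSchwartz_sub (χ ψ : 𝓢(Sp d, ℂ)) :
    conjSchwartz (χ - ψ) = conjSchwartz χ - conjSchwartz ψ := by
  ext t; simp [conjSchwartz_apply]

theorem conjSchwartz_smul (c : ℂ) (χ : 𝓢(Sp d, ℂ)) :
    conjSchwartz (c • χ) = starRingEnd ℂ c • conjSchwartz χ := by
  ext t; simp [conjSchwartz_apply]

theorem shiftSchwartz_sub (z : TF d) (χ ψ : 𝓢(Sp d, ℂ)) :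
    shiftSchwartz z (χ - ψ) = shiftSchwartz z χ - shiftSchwartz z ψ := by
  simp [shiftSchwartz]

theorem shiftSchwartz_zero (χ : 𝓢(Sp d, ℂ)) : shiftSchwartz 0 χ = χ := by
  ext t
  simp [shiftSchwartz_apply, shiftFun, tfChar]

/-- The reproducing formula at `conj χ` with absolute values inside the integral, which may be
infinite on the right. -/
theorem enorm_apply_le_lintegral (φ : 𝓢(Sp d, ℂ)) (f : 𝓢'(Sp d, ℂ)) (χ : 𝓢(Sp d, ℂ)) :
    ENNReal.ofReal (∫ t, ‖φ t‖ ^ 2) * ‖f (conjSchwartz χ)‖ₑ ≤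
      ∫⁻ w, ‖stft φ f w‖ₑ * ‖stftS φ χ w‖ₑ := by
  have h := integral_stft_mul_stftConj φ (conjSchwartz χ) f
  have h0 : 0 ≤ ∫ t, ‖φ t‖ ^ 2 := integral_nonneg fun t => by positivity
  have h1 : ENNReal.ofReal (∫ t, ‖φ t‖ ^ 2) * ‖f (conjSchwartz χ)‖ₑ =
      ‖∫ w : TF d, stft φ f w * stftConj φ (conjSchwartz χ) w‖ₑ := by
    rw [h, enorm_mul, ← ofReal_norm (((∫ t, ‖φ t‖ ^ 2 : ℝ) : ℂ)), Complex.norm_real,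
      Real.norm_of_nonneg h0]
  rw [h1]
  refine (enorm_integral_le_lintegral_enorm _).trans (le_of_eq ?_)
  refine lintegral_congr fun w => ?_
  rw [enorm_mul, ← ofReal_norm (stftConj φ _ w), norm_stftConj, conjSchwartz_conjSchwartz,
    ofReal_norm]

/-- The short-time Fourier transform of any tempered distribution oscillates at small scales by
at most its correlation with a kernel of small integral. -/
theorem exists_oscBound {φ : 𝓢(Sp d, ℂ)} (hφ : φ ≠ 0) :
    ∃ ε : ℝ, 0 < ε ∧ ∃ K : TF d → ℝ≥0∞, Measurable K ∧ ∫⁻ y, K y ≤ 2⁻¹ ∧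
      ∀ f : 𝓢'(Sp d, ℂ), OscBound (fun z => ‖stft φ f z‖ₑ) K ε := by
  set E₀ : ℝ := ∫ t, ‖φ t‖ ^ 2 with hE₀
  have hE₀pos : 0 < E₀ := integral_normSq_pos hφ
  set r := Module.finrank ℝ (TF d) + 1 with hr
  obtain ⟨q, hq, hqb⟩ := exists_seminorm_stftS_decay φ r
  have hint := integrable_inv_one_add_norm_pow (TF d)
  rw [← hr] at hint
  set I : ℝ := ∫ y : TF d, ((1 + ‖y‖) ^ r)⁻¹ with hI
  have hI0 : 0 ≤ I := integral_nonneg fun t => by positivity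
  -- Chosen so that `η * I ≤ 1/2`, the bound required of `∫ K`.
  set η : ℝ := (2 * (I + 1))⁻¹ with hη
  have hη0 : 0 < η := by positivity
  have hlim : Tendsto (fun u : TF d => q (shiftSchwartz u φ - φ)) (𝓝 0) (𝓝 0) := by
    have hc : Continuous fun u : TF d => q (shiftSchwartz u φ - φ) :=
      hq.comp ((continuous_shiftSchwartz φ).sub continuous_const)
    have := hc.tendsto 0
    rwa [shiftSchwartz_zero, sub_self, map_zero] at this
  obtain ⟨ε, hε, hball⟩ := Metric.eventually_nhds_iff.mp
    (hlim.eventually (gt_mem_nhds (mul_pos hη0 hE₀pos)))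
  let K : TF d → ℝ≥0∞ := fun y => ENNReal.ofReal (η * ((1 + ‖y‖) ^ r)⁻¹)
  have hKm : Measurable K := by fun_prop
  refine ⟨ε, hε, K, hKm, ?_, fun f => ?_⟩
  · rw [← ofReal_integral_eq_lintegral_ofReal (hint.const_mul η)
      (Eventually.of_forall fun y => by positivity), integral_const_mul, ← hI]
    rw [show (2⁻¹ : ℝ≥0∞) = ENNReal.ofReal 2⁻¹ by
      rw [ENNReal.ofReal_inv_of_pos two_pos, ENNReal.ofReal_ofNat]]
    refine ENNReal.ofReal_le_ofReal ?_
    rw [hη, mul_inv, mul_assoc]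
    refine mul_le_of_le_one_right (by positivity) ?_
    rw [inv_mul_le_one₀ (by positivity)]
    linarith
  have key : ∀ z u : TF d, ‖u‖ < ε →
      ‖stft φ f (z + u)‖ₑ ≤ ‖stft φ f z‖ₑ + corr (fun z => ‖stft φ f z‖ₑ) K z ∧
      ‖stft φ f z‖ₑ ≤ ‖stft φ f (z + u)‖ₑ + corr (fun z => ‖stft φ f z‖ₑ) K z := by
    intro z u hu
    set c := tfChar (-u.snd) z.fst with hc
    set χ := shiftSchwartz z (shiftSchwartz u φ - φ) with hχ
    -- The phase `c` from composing shifts prevents comparing the values themselves, but it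
    -- disappears in the moduli.
    have hdiff : f (conjSchwartz χ) = starRingEnd ℂ c * stft φ f (z + u) - stft φ f z := by
      rw [hχ, shiftSchwartz_sub, shiftSchwartz_shiftSchwartz, conjSchwartz_sub,
        conjSchwartz_smul, map_sub, map_smul, smul_eq_mul, stft, stft]
    have hcn : ‖starRingEnd ℂ c * stft φ f (z + u)‖ₑ = ‖stft φ f (z + u)‖ₑ := by
      rw [enorm_mul, ← ofReal_norm (starRingEnd ℂ c), RCLike.norm_conj, norm_tfChar,
        ENNReal.ofReal_one, one_mul]
    have hbound : ‖f (conjSchwartz χ)‖ₑ ≤ corr (fun z => ‖stft φ f z‖ₑ) K z := by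
      have h1 : ENNReal.ofReal E₀ * ‖f (conjSchwartz χ)‖ₑ ≤
          ENNReal.ofReal E₀ * corr (fun z => ‖stft φ f z‖ₑ) K z := by
        refine (enorm_apply_le_lintegral φ f χ).trans ?_
        rw [corr, ← lintegral_const_mul' _ _ ENNReal.ofReal_ne_top]
        refine lintegral_mono fun w => ?_
        rw [mul_left_comm]
        gcongr
        rw [← ofReal_norm, ← ENNReal.ofReal_mul hE₀pos.le]
        refine ENNReal.ofReal_le_ofReal ?_
        rw [hχ, norm_stftS_shift]
        have h2 := hqb (shiftSchwartz u φ - φ) (w - z)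
        have h3 : q (shiftSchwartz u φ - φ) < η * E₀ := hball (by simpa using hu)
        rw [← mul_assoc, ← div_eq_mul_inv, le_div_iff₀ (by positivity)]
        linarith
      have h4 : ENNReal.ofReal E₀ ≠ 0 := by simpa using hE₀pos
      exact (ENNReal.mul_le_mul_iff_right h4 ENNReal.ofReal_ne_top).mp h1
    constructor
    · calc ‖stft φ f (z + u)‖ₑ = ‖stft φ f z + f (conjSchwartz χ)‖ₑ := by
            rw [hdiff, add_sub_cancel, hcn]
        _ ≤ _ := (enorm_add_le _ _).trans (add_le_add_right hbound _)
    · calc ‖stft φ f z‖ₑ = ‖starRingEnd ℂ c * stft φ f (z + u) - f (conjSchwartz χ)‖ₑ := by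
            rw [hdiff, sub_sub_cancel]
        _ ≤ ‖stft φ f (z + u)‖ₑ + ‖f (conjSchwartz χ)‖ₑ := by
            rw [← hcn]; exact enorm_sub_le
        _ ≤ _ := add_le_add_right hbound _
  -- Centring the estimate at `z` or at `z'` puts the correlation at the corresponding endpoint.
  intro z z' hz
  constructor
  · have := (key z (z' - z) (by rwa [← dist_eq_norm, dist_comm])).2
    rwa [add_sub_cancel] at this
  · have := (key z' (z - z') (by rwa [← dist_eq_norm])).1
    rwa [add_sub_cancel] at this

end Oscillation

/-! ### Moyal's identity on `L²`. -/

section Moyal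

variable {d : ℕ}

/-- A Schwartz function as an element of `L²`. -/
def toL2 (χ : 𝓢(Sp d, ℂ)) : L2 d := χ.toLp 2 volume

theorem toL2_ae_eq (χ : 𝓢(Sp d, ℂ)) : toL2 χ =ᵐ[volume] χ := χ.coeFn_toLp 2 volume

theorem toL2_apply (χ ψ : 𝓢(Sp d, ℂ)) : (toL2 χ : 𝓢'(Sp d, ℂ)) ψ = ∫ t, ψ t * χ t := by
  rw [Lp.toTemperedDistribution_apply]
  refine integral_congr_ae ?_
  filter_upwards [toL2_ae_eq χ] with t ht
  rw [ht, smul_eq_mul]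

theorem stft_toL2 (φ χ : 𝓢(Sp d, ℂ)) (w : TF d) :
    stft φ ((toL2 χ : L2 d) : 𝓢'(Sp d, ℂ)) w = stftS φ χ w := by
  rw [stft, toL2_apply, stftS]
  refine integral_congr_ae (Eventually.of_forall fun t => ?_)
  simp [conjSchwartz_apply, mul_comm]

theorem continuous_stftS (φ χ : 𝓢(Sp d, ℂ)) : Continuous (stftS φ χ) := by
  rw [← funext (stft_toL2 φ χ)]
  exact continuous_stft φ _

theorem integrable_stftS (φ χ : 𝓢(Sp d, ℂ)) : Integrable (stftS φ χ) := by
  obtain ⟨q, -, hq⟩ := exists_seminorm_stftS_decay φ (Module.finrank ℝ (TF d) + 1)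
  refine ((integrable_inv_one_add_norm_pow (TF d)).const_mul (q χ)).mono'
    (continuous_stftS φ χ).aestronglyMeasurable (Eventually.of_forall fun w => ?_)
  rw [← div_eq_mul_inv, le_div_iff₀ (by positivity), mul_comm]
  exact hq χ w

theorem memLp_two_stftS (φ χ : 𝓢(Sp d, ℂ)) : MemLp (stftS φ χ) 2 volume := by
  obtain ⟨q, -, hq⟩ := exists_seminorm_stftS_decay φ 0
  rw [memLp_two_iff_integrable_sq_norm (continuous_stftS φ χ).aestronglyMeasurable]
  refine ((integrable_stftS φ χ).norm.const_mul (q χ)).mono'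
    ((continuous_stftS φ χ).norm.pow 2).aestronglyMeasurable (Eventually.of_forall fun w => ?_)
  have := hq χ w
  rw [pow_zero, one_mul] at this
  rw [Real.norm_of_nonneg (by positivity), pow_two]
  gcongr

theorem eLpNorm_two_eq_sqrt {α : Type*} [MeasurableSpace α] {μ : Measure α} {F : α → ℂ}
    (hF : MemLp F 2 μ) : eLpNorm F 2 μ = ENNReal.ofReal (√(∫ x, ‖F x‖ ^ 2 ∂μ)) := by
  rw [hF.eLpNorm_eq_integral_rpow_norm (by norm_num) (by norm_num), Real.sqrt_eq_rpow]
  simp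

/-- Moyal's identity for Schwartz functions. -/
theorem eLpNorm_stftS (φ χ : 𝓢(Sp d, ℂ)) :
    eLpNorm (stftS φ χ) 2 volume = ENNReal.ofReal (√(∫ t, ‖φ t‖ ^ 2)) * ‖toL2 χ‖ₑ := by
  have h1 : ‖toL2 χ‖ₑ = eLpNorm χ 2 volume := by
    rw [Lp.enorm_def]
    exact eLpNorm_congr_ae (toL2_ae_eq χ)
  rw [h1, eLpNorm_two_eq_sqrt (χ.memLp 2 volume), eLpNorm_two_eq_sqrt (memLp_two_stftS φ χ),
    ← ENNReal.ofReal_mul (by positivity), ← Real.sqrt_mul (integral_nonneg fun t => by positivity)]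
  congr 2
  -- Pairing `χ` with its own conjugate turns the reproducing formula into the norm identity.
  have h := integral_stft_mul_stftConj φ (conjSchwartz χ) ((toL2 χ : L2 d) : 𝓢'(Sp d, ℂ))
  have h2 : ((toL2 χ : L2 d) : 𝓢'(Sp d, ℂ)) (conjSchwartz χ) = ((∫ t, ‖χ t‖ ^ 2 : ℝ) : ℂ) := by
    rw [toL2_apply, integral_normSq_ofReal]
    rfl
  have h3 : ∫ w : TF d, stft φ ((toL2 χ : L2 d) : 𝓢'(Sp d, ℂ)) w *
      stftConj φ (conjSchwartz χ) w = ((∫ w, ‖stftS φ χ w‖ ^ 2 : ℝ) : ℂ) := by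
    rw [← integral_complex_ofReal]
    refine integral_congr_ae (Eventually.of_forall fun w => ?_)
    simp only
    rw [stft_toL2, stftConj_eq, conjSchwartz_conjSchwartz, Complex.mul_conj,
      Complex.normSq_eq_norm_sq]
  rw [h2, h3] at h
  exact_mod_cast h

theorem stft_sub (φ : 𝓢(Sp d, ℂ)) (f g : L2 d) :
    stft φ ((f - g : L2 d) : 𝓢'(Sp d, ℂ)) =
      stft φ (f : 𝓢'(Sp d, ℂ)) - stft φ (g : 𝓢'(Sp d, ℂ)) := by
  ext w
  have := map_sub (Lp.toTemperedDistributionCLM ℂ (volume : Measure (Sp d)) 2) f g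
  simp only [Lp.toTemperedDistributionCLM_apply] at this
  simp only [stft, this, Pi.sub_apply]
  rfl

theorem continuous_stft_L2 (φ : 𝓢(Sp d, ℂ)) (w : TF d) :
    Continuous fun f : L2 d => stft φ (f : 𝓢'(Sp d, ℂ)) w := by
  have h := (Lp.toTemperedDistributionCLM ℂ (volume : Measure (Sp d)) 2).continuous
  exact (continuous_eval_const (conjSchwartz (shiftSchwartz w φ))).comp h

/-- Moyal's identity. -/
theorem eLpNorm_stft_L2 (φ : 𝓢(Sp d, ℂ)) (f : L2 d) :
    eLpNorm (stft φ (f : 𝓢'(Sp d, ℂ))) 2 volume =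
      ENNReal.ofReal (√(∫ t, ‖φ t‖ ^ 2)) * ‖f‖ₑ := by
  set c := ENNReal.ofReal (√(∫ t, ‖φ t‖ ^ 2)) with hc
  have happrox : ∀ f : L2 d, ∃ χ : ℕ → 𝓢(Sp d, ℂ),
      Tendsto (fun n => toL2 (χ n)) atTop (𝓝 f) := by
    intro f
    have hd := SchwartzMap.denseRange_toLpCLM (E := Sp d) (F := ℂ) (p := 2) (μ := volume)
      (by norm_num)
    obtain ⟨u, hu, hlim⟩ := mem_closure_iff_seq_limit.mp (hd f)
    choose χ hχ using hu
    refine ⟨χ, ?_⟩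
    have : (fun n => toL2 (χ n)) = u := funext fun n => hχ n
    rwa [this]
  have hS : ∀ χ : 𝓢(Sp d, ℂ), eLpNorm (stft φ ((toL2 χ : L2 d) : 𝓢'(Sp d, ℂ))) 2 volume =
      c * ‖toL2 χ‖ₑ := fun χ => by
    rw [show stft φ ((toL2 χ : L2 d) : 𝓢'(Sp d, ℂ)) = stftS φ χ from funext (stft_toL2 φ χ)]
    exact eLpNorm_stftS φ χ
  have hlimc : ∀ {u : ℕ → L2 d} {f : L2 d}, Tendsto u atTop (𝓝 f) →
      Tendsto (fun n => c * ‖u n‖ₑ) atTop (𝓝 (c * ‖f‖ₑ)) := fun h =>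
    ENNReal.Tendsto.const_mul h.enorm (Or.inr ENNReal.ofReal_ne_top)
  -- Fatou along Schwartz approximants, whose transforms converge pointwise. The reverse inequality
  -- then follows from the triangle inequality, with this bound applied to the approximation error.
  have hle : ∀ f : L2 d, eLpNorm (stft φ (f : 𝓢'(Sp d, ℂ))) 2 volume ≤ c * ‖f‖ₑ := by
    intro f
    obtain ⟨χ, hχ⟩ := happrox f
    refine (Lp.eLpNorm_lim_le_liminf_eLpNorm
      (f := fun n => stft φ (toL2 (χ n) : 𝓢'(Sp d, ℂ)))
      (fun n => (continuous_stft φ _).aestronglyMeasurable) _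
      (Eventually.of_forall fun w => ((continuous_stft_L2 φ w).tendsto f).comp hχ)).trans ?_
    simp_rw [hS]
    exact (hlimc hχ).liminf_eq.le
  refine le_antisymm (hle f) ?_
  obtain ⟨χ, hχ⟩ := happrox f
  have hlim2 : Tendsto (fun n => eLpNorm (stft φ (f : 𝓢'(Sp d, ℂ))) 2 volume +
      c * ‖toL2 (χ n) - f‖ₑ) atTop
      (𝓝 (eLpNorm (stft φ (f : 𝓢'(Sp d, ℂ))) 2 volume + c * ‖(0 : L2 d)‖ₑ)) := by
    refine tendsto_const_nhds.add (hlimc ?_)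
    simpa using hχ.sub_const f
  rw [enorm_zero, mul_zero, add_zero] at hlim2
  refine le_of_tendsto_of_tendsto' (hlimc hχ) hlim2 fun n => ?_
  rw [← hS]
  calc eLpNorm (stft φ (toL2 (χ n) : 𝓢'(Sp d, ℂ))) 2 volume
      = eLpNorm (stft φ (f : 𝓢'(Sp d, ℂ)) +
          stft φ ((toL2 (χ n) - f : L2 d) : 𝓢'(Sp d, ℂ))) 2 volume := by
        rw [stft_sub, add_sub_cancel]
    _ ≤ _ := eLpNorm_add_le (continuous_stft φ _).aestronglyMeasurable
        (continuous_stft φ _).aestronglyMeasurable (by norm_num)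
    _ ≤ _ := add_le_add_right (hle _) _

end Moyal

end GaborQC

namespace GaborQC

/-! ### Extended `ℓᵖ` norms. -/

section Sequences

/-- The extended `ℓᵖ` norm of a family. -/
def lpENorm {J : Type*} (p : ℝ≥0∞) (a : J → ℝ≥0∞) : ℝ≥0∞ :=
  if p = ∞ then ⨆ j, a j else (∑' j, a j ^ p.toReal) ^ (1 / p.toReal)

theorem exists_lp_of_lpENorm {J : Type*} {p : ℝ≥0∞} (hp : 1 ≤ p) (c : J → ℂ)
    (h : lpENorm p (fun j => ‖c j‖ₑ) ≠ ∞) :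
    ∃ x : lp (fun _ : J => ℂ) p, (∀ j, x j = c j) ∧
      ‖x‖ = (lpENorm p fun j => ‖c j‖ₑ).toReal := by
  by_cases htop : p = ∞
  · subst htop
    simp only [lpENorm, if_true] at h ⊢
    have hb : BddAbove (range fun j => ‖c j‖) := by
      refine ⟨(⨆ j, ‖c j‖ₑ).toReal, ?_⟩
      rintro _ ⟨j, rfl⟩
      change ‖c j‖ ≤ _
      rw [← toReal_enorm]
      exact ENNReal.toReal_mono h (le_iSup (fun j => ‖c j‖ₑ) j)
    refine ⟨⟨c, memℓp_infty hb⟩, fun j => rfl, ?_⟩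
    rw [lp.norm_eq_ciSup, ENNReal.toReal_iSup fun j => enorm_ne_top]
    simp
  · have hP : 0 < p.toReal := ENNReal.toReal_pos (by positivity) htop
    simp only [lpENorm, if_neg htop] at h ⊢
    have hsum : ∑' j, ‖c j‖ₑ ^ p.toReal ≠ ∞ := by
      intro h'
      rw [h', ENNReal.top_rpow_of_pos (by positivity)] at h
      exact h rfl
    have hterm : ∀ j, (‖c j‖ₑ ^ p.toReal).toReal = ‖c j‖ ^ p.toReal := fun j => by
      rw [← ENNReal.toReal_rpow, toReal_enorm]
    have hs : Summable fun j => ‖c j‖ ^ p.toReal := by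
      simpa only [hterm] using ENNReal.summable_toReal hsum
    refine ⟨⟨c, memℓp_gen hs⟩, fun j => rfl, ?_⟩
    rw [lp.norm_eq_tsum_rpow hP, ← ENNReal.toReal_rpow,
      ENNReal.tsum_toReal_eq fun j => ENNReal.rpow_ne_top_of_nonneg hP.le enorm_ne_top]
    simp only [hterm]

end Sequences

/-! ### Absorbing the oscillation error. -/

section FrameBounds

variable {V : Type*} [NormedAddCommGroup V] [InnerProductSpace ℝ V] [FiniteDimensional ℝ V]
  [MeasurableSpace V] [BorelSpace V]

/-- Half of `x` is cancelled from both sides, which is where finiteness of `x`, that is membership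
in `M^p`, is essential. -/
theorem le_two_mul_of_le_add_half {x y κ : ℝ≥0∞} (hx : x ≠ ∞) (hκ : κ ≤ 2⁻¹)
    (h : x ≤ y + κ * x) : x ≤ 2 * y := by
  have h1 : x ≤ y + 2⁻¹ * x := h.trans (by gcongr)
  have h2 : 2⁻¹ * x ≤ y := by
    have h3 : 2⁻¹ * x + 2⁻¹ * x ≤ y + 2⁻¹ * x := by
      rwa [← add_mul, ENNReal.inv_two_add_inv_two, one_mul]
    exact (ENNReal.add_le_add_iff_right (ENNReal.mul_ne_top (by simp) hx)).mp h3
  calc x = 2 * (2⁻¹ * x) := by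
        rw [← mul_assoc, ENNReal.mul_inv_cancel two_ne_zero (by simp), one_mul]
    _ ≤ 2 * y := by gcongr

/-- Sampling inequalities for functions with small oscillation. -/
theorem exists_sampling_bounds {K : V → ℝ≥0∞} (hK : Measurable K) (hK2 : ∫⁻ y, K y ≤ 2⁻¹)
    {ε δ : ℝ} (hε : 0 < ε) (hδ : 0 < δ) (hδε : δ ≤ ε) {ι T : Type*} [Fintype ι] [Countable T]
    {l : ι × T → V} (hcov : ∀ z, ∃ j, dist z (l j) < ε)
    (hdisj : ∀ i, Pairwise fun s t =>
      Disjoint (Metric.ball (l (i, s)) δ) (Metric.ball (l (i, t)) δ))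
    {p : ℝ≥0∞} (hp : 1 ≤ p) :
    ∃ A B : ℝ≥0∞, A ≠ ∞ ∧ B ≠ ∞ ∧ ∀ F : V → ℂ, Continuous F →
      OscBound (fun z => ‖F z‖ₑ) K ε → eLpNorm F p volume ≠ ∞ →
      eLpNorm F p volume ≤ A * lpENorm p (fun j => ‖F (l j)‖ₑ) ∧
      lpENorm p (fun j => ‖F (l j)‖ₑ) ≤ B * eLpNorm F p volume := by
  have h1K : 1 + ∫⁻ y, K y ≤ 2 := by
    calc 1 + ∫⁻ y, K y ≤ 1 + 2⁻¹ := by gcongr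
      _ ≤ 1 + 1 := by gcongr; simp
      _ = 2 := one_add_one_eq_two
  by_cases htop : p = ∞
  · subst htop
    refine ⟨2, 2, by simp, by simp, fun F hF hosc hfin => ?_⟩
    simp only [lpENorm, if_true, eLpNorm_exponent_top, eLpNormEssSup] at hfin ⊢
    refine ⟨le_two_mul_of_le_add_half hfin hK2 (essSup_le_iSup_samples hK hosc hcov),
      iSup_le fun j => ?_⟩
    exact (le_essSup_of_oscBound hK hε hosc (l j)).trans (by gcongr)
  · have hp0 : p ≠ 0 := (zero_lt_one.trans_le hp).ne'
    have hP : 1 ≤ p.toReal := by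
      rw [← ENNReal.toReal_one]; exact ENNReal.toReal_mono htop hp
    set P := p.toReal with hPdef
    have hvol : ∀ r : ℝ, 0 < r → volume (Metric.ball (0 : V) r) ^ (1 / P) ≠ 0 ∧
        volume (Metric.ball (0 : V) r) ^ (1 / P) ≠ ∞ := fun r hr =>
      ⟨(ENNReal.rpow_pos (Metric.measure_ball_pos _ _ hr) measure_ball_lt_top.ne).ne',
        ENNReal.rpow_ne_top_of_nonneg (by positivity) measure_ball_lt_top.ne⟩
    obtain ⟨hv0, hvt⟩ := hvol δ hδ
    refine ⟨2 * volume (Metric.ball (0 : V) ε) ^ (1 / P),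
      (volume (Metric.ball (0 : V) δ) ^ (1 / P))⁻¹ * ((Fintype.card ι : ℝ≥0∞) ^ (1 / P) * 2),
      ENNReal.mul_ne_top (by simp) (hvol ε hε).2,
      ENNReal.mul_ne_top (ENNReal.inv_ne_top.mpr hv0) (ENNReal.mul_ne_top
        (ENNReal.rpow_ne_top_of_nonneg (by positivity) (by simp)) (by simp)),
      fun F hF hosc hfin => ?_⟩
    rw [eLpNorm_eq_lintegral_rpow_enorm_toReal hp0 htop, ← hPdef] at hfin ⊢
    simp only [lpENorm, if_neg htop, ← hPdef]
    have hFm : Measurable fun z => ‖F z‖ₑ := hF.enorm.measurable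
    constructor
    · rw [mul_assoc]
      exact le_two_mul_of_le_add_half hfin hK2
        (lintegral_rpow_le_sum_samples hFm hK hosc hcov hP)
    · have h := sum_samples_le_lintegral_rpow hFm hK (hosc.mono hδε) hdisj hP
      rw [mul_assoc, ← ENNReal.div_eq_inv_mul, ENNReal.le_div_iff_mul_le (Or.inl hv0) (Or.inl hvt),
        mul_comm]
      refine h.trans ?_
      rw [mul_assoc]
      gcongr

end FrameBounds

/-! ### Gabor coefficients as samples, and the frame bounds. -/

section Gabor

variable {d : ℕ}

theorem shiftL2_toL2 (z : TF d) (χ : 𝓢(Sp d, ℂ)) : shiftL2 z (toL2 χ) = toL2 (shiftSchwartz z χ) := by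
  refine Lp.ext ?_
  have h1 : (fun t => toL2 χ (t - z.fst)) =ᵐ[volume] fun t => χ (t - z.fst) :=
    (measurePreserving_sub_right volume z.fst).quasiMeasurePreserving.ae_eq_comp (toL2_ae_eq χ)
  filter_upwards [MemLp.coeFn_toLp (memLp_shiftFun z (Lp.memLp (toL2 χ))), h1,
    toL2_ae_eq (shiftSchwartz z χ)] with t h2 h3 h4
  rw [h4, shiftSchwartz_apply]
  change shiftL2 z (toL2 χ) t = _ at h2
  rw [h2, shiftFun, shiftFun, h3]

/-- The pairing is the left side of the reproducing formula, normalised; with Schwartz windows it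
reduces to evaluation of the distribution. -/
theorem pairM_toL2 {φ : 𝓢(Sp d, ℂ)} (hφ : φ ≠ 0) (f : 𝓢'(Sp d, ℂ)) (χ : 𝓢(Sp d, ℂ)) :
    pairM φ f ((toL2 χ : L2 d) : 𝓢'(Sp d, ℂ)) = f (conjSchwartz χ) := by
  have h := integral_stft_mul_stftConj φ (conjSchwartz χ) f
  have h0 : ((∫ t, ‖φ t‖ ^ 2 : ℝ) : ℂ) ≠ 0 := by exact_mod_cast (integral_normSq_pos hφ).ne'
  simp only [stftConj_eq, conjSchwartz_conjSchwartz] at h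
  rw [pairM]
  simp only [stft_toL2]
  rw [h, inv_mul_cancel_left₀ h0]

theorem inner_toL2 (χ : 𝓢(Sp d, ℂ)) (f : L2 d) :
    ⟪toL2 χ, f⟫_ℂ = (f : 𝓢'(Sp d, ℂ)) (conjSchwartz χ) := by
  rw [L2.inner_def, Lp.toTemperedDistribution_apply]
  refine integral_congr_ae ?_
  filter_upwards [toL2_ae_eq χ] with t ht
  rw [ht, RCLike.inner_apply, conjSchwartz_apply, smul_eq_mul, mul_comm]

theorem norm_apply_conj_shift_shift (φ : 𝓢(Sp d, ℂ)) (f : 𝓢'(Sp d, ℂ)) (z u : TF d) :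
    ‖f (conjSchwartz (shiftSchwartz z (shiftSchwartz u φ)))‖ = ‖stft φ f (z + u)‖ := by
  rw [shiftSchwartz_shiftSchwartz, conjSchwartz_smul, map_smul, norm_smul, RCLike.norm_conj,
    norm_tfChar, one_mul, stft]

theorem gaborSystem_toL2 {N : ℕ} (φ : 𝓢(Sp d, ℂ)) (ζ : Fin N → TF d) (T : Set (TF d))
    (j : Fin N × T) :
    gaborSystem (fun i => shiftL2 (ζ i) (toL2 φ)) T j =
      toL2 (shiftSchwartz (j.2 : TF d) (shiftSchwartz (ζ j.1) φ)) := by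
  rw [gaborSystem, shiftL2_toL2, shiftL2_toL2]

theorem memM_one_toL2 (φ : 𝓢(Sp d, ℂ)) : MemM φ 1 ((toL2 φ : L2 d) : 𝓢'(Sp d, ℂ)) := by
  rw [MemM, funext (stft_toL2 φ φ), memLp_one_iff_integrable]
  exact integrable_stftS φ φ

/-- A Gabor system over a sufficiently dense union of translates of a uniformly discrete set is an
`Mᵖ`-frame. -/
theorem isMFrame_gaborSystem {φ : 𝓢(Sp d, ℂ)} (hφ : φ ≠ 0) {ε : ℝ} (hε : 0 < ε)
    {K : TF d → ℝ≥0∞} (hK : Measurable K) (hK2 : ∫⁻ y, K y ≤ 2⁻¹)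
    (hosc : ∀ f : 𝓢'(Sp d, ℂ), OscBound (fun z => ‖stft φ f z‖ₑ) K ε) {N : ℕ}
    (ζ : Fin N → TF d) {T : Set (TF d)} (hT : IsDelone T)
    (hcov : ∀ z : TF d, ∃ j : Fin N × T, dist z (j.2 + ζ j.1) < ε) {p : ℝ≥0∞} (hp : 1 ≤ p) :
    IsMFrame φ p (gaborSystem (fun i => shiftL2 (ζ i) (toL2 φ)) T) := by
  obtain ⟨D, rfl⟩ := hT
  have hr : 0 < (D.packingRadius : ℝ) := by exact_mod_cast D.packingRadius_pos
  -- Half the packing radius makes the balls around each translate of `D` disjoint; the cap at `ε`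
  -- keeps the oscillation bound available.
  set δ : ℝ := min ε (D.packingRadius / 2) with hδ
  have hδ0 : 0 < δ := lt_min hε (by positivity)
  have hdisj₀ : ∀ x : TF d, Pairwise fun s t : (D : Set (TF d)) =>
      Disjoint (Metric.ball ((s : TF d) + x) δ) (Metric.ball ((t : TF d) + x) δ) := by
    intro x s t hst
    refine Metric.ball_disjoint_ball ?_
    rw [dist_add_right]
    have := D.packingRadius_lt_dist_of_mem_ne s.2 t.2 fun h => hst (Subtype.ext h)
    linarith [min_le_right ε ((D.packingRadius : ℝ) / 2)]
  have hcount : Countable (D : Set (TF d)) := by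
    refine Set.countable_coe_iff.mpr (Set.PairwiseDisjoint.countable_of_isOpen
      (s := fun t : TF d => Metric.ball (t + 0) δ) (fun s hs t ht hst => ?_)
      (fun _ _ => Metric.isOpen_ball) (fun _ _ => Metric.nonempty_ball.mpr hδ0))
    exact hdisj₀ 0 (i := ⟨s, hs⟩) (j := ⟨t, ht⟩) fun h => hst (congr_arg Subtype.val h)
  obtain ⟨A, B, hA, hB, hAB⟩ := exists_sampling_bounds hK hK2 hε hδ0 (min_le_left _ _)
    (l := fun j : Fin N × (D : Set (TF d)) => (j.2 : TF d) + ζ j.1) hcov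
    (fun i => hdisj₀ (ζ i)) hp
  -- Adding one makes both constants strictly positive without excluding `A = 0` or `B = 0`.
  refine ⟨(A.toReal + 1)⁻¹, B.toReal + 1, by positivity, by positivity, fun f hf => ?_⟩
  obtain ⟨hlow, hup⟩ := hAB (stft φ f) (continuous_stft φ f) (hosc f) hf.eLpNorm_ne_top
  let c : Fin N × (D : Set (TF d)) → ℂ := fun j =>
    pairM φ f ((gaborSystem (fun i => shiftL2 (ζ i) (toL2 φ)) D j : L2 d) : 𝓢'(Sp d, ℂ))
  have hc : (fun j => ‖c j‖ₑ) = fun j => ‖stft φ f ((j.2 : TF d) + ζ j.1)‖ₑ := by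
    ext1 j
    simp only [c]
    rw [gaborSystem_toL2, pairM_toL2 hφ, ← ofReal_norm, norm_apply_conj_shift_shift, ofReal_norm]
  rw [← hc] at hlow hup
  have hfin : lpENorm p (fun j => ‖c j‖ₑ) ≠ ∞ :=
    ne_top_of_le_ne_top (ENNReal.mul_ne_top hB hf.eLpNorm_ne_top) hup
  obtain ⟨x, hx, hxn⟩ := exists_lp_of_lpENorm hp c hfin
  refine ⟨x, hx, ?_, ?_⟩
  · have h := ENNReal.toReal_mono (ENNReal.mul_ne_top hA hfin) hlow
    rw [ENNReal.toReal_mul, ← hxn] at h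
    rw [inv_mul_le_iff₀ (by positivity)]
    refine h.trans (mul_le_mul_of_nonneg_right (by linarith) ?_)
    rw [hxn]
    exact ENNReal.toReal_nonneg
  · have h := ENNReal.toReal_mono (ENNReal.mul_ne_top hB hf.eLpNorm_ne_top) hup
    rw [ENNReal.toReal_mul, ← hxn] at h
    refine h.trans ?_
    exact mul_le_mul_of_nonneg_right (by linarith) ENNReal.toReal_nonneg

/-- Over `L²`, an `M²`-frame of Schwartz functions is a frame. -/
theorem isFrame_of_isMFrame_two {φ : 𝓢(Sp d, ℂ)} (hφ : φ ≠ 0) {J : Type*} {χ : J → 𝓢(Sp d, ℂ)}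
    (h : IsMFrame φ 2 fun j => toL2 (χ j)) : IsFrame fun j => toL2 (χ j) := by
  obtain ⟨A, B, hA, hB, hAB⟩ := h
  have hE := integral_normSq_pos hφ
  set E₀ : ℝ := ∫ t, ‖φ t‖ ^ 2 with hE₀
  -- By Moyal the `M²` norm is `√E₀` times the `L²` norm; squaring gives these constants.
  refine ⟨A ^ 2 * E₀, B ^ 2 * E₀, by positivity, by positivity, fun f => ?_⟩
  have hmoyal := eLpNorm_stft_L2 φ f
  have hmem : MemM φ 2 (f : 𝓢'(Sp d, ℂ)) := by
    refine ⟨(continuous_stft φ _).aestronglyMeasurable, ?_⟩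
    rw [hmoyal]
    exact ENNReal.mul_lt_top ENNReal.ofReal_lt_top enorm_lt_top
  have hnorm : normM φ 2 (f : 𝓢'(Sp d, ℂ)) = √E₀ * ‖f‖ := by
    rw [normM, hmoyal, ENNReal.toReal_mul, ENNReal.toReal_ofReal (by positivity), toReal_enorm]
  obtain ⟨c, hc, hlow, hup⟩ := hAB f hmem
  have hcj : ∀ j, ‖⟪toL2 (χ j), f⟫_ℂ‖ ^ 2 = ‖c j‖ ^ (2 : ℝ≥0∞).toReal := by
    intro j
    rw [hc, pairM_toL2 hφ, inner_toL2, ENNReal.toReal_ofNat, Real.rpow_ofNat]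
  have hsum : ‖c‖ ^ 2 = ∑' j, ‖c j‖ ^ (2 : ℝ≥0∞).toReal := by
    have := lp.norm_rpow_eq_tsum (p := 2) (by norm_num) c
    rwa [ENNReal.toReal_ofNat, Real.rpow_ofNat] at this
  simp only [hcj]
  rw [hnorm] at hlow hup
  have hsq : ∀ C : ℝ, (C * (√E₀ * ‖f‖)) ^ 2 = C ^ 2 * E₀ * ‖f‖ ^ 2 := fun C => by
    rw [mul_pow, mul_pow, Real.sq_sqrt hE.le, mul_assoc]
  refine ⟨(lp.memℓp c).summable (by norm_num), ?_, ?_⟩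
  · rw [← hsum, ← hsq]
    gcongr
  · rw [← hsum, ← hsq]
    gcongr

end Gabor

end GaborQC

end

theorem theorem1p3 (d : ℕ) (Λ : Set (GaborQC.TF d)) (hΛ : GaborQC.IsQuasicrystal Λ)
    (φ : 𝓢(GaborQC.Sp d, ℂ)) (hφ : φ ≠ 0) :
    ∃ g : GaborQC.L2 d, GaborQC.MemM φ 1 (g : 𝓢'(GaborQC.Sp d, ℂ)) ∧
      ∃ (N : ℕ) (ζ : Fin N → GaborQC.TF d),
        ∀ T ∈ GaborQC.hull Λ,
          GaborQC.IsFrame (GaborQC.gaborSystem (fun i => GaborQC.shiftL2 (ζ i) g) T) ∧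
          ∀ p : ℝ≥0∞, 1 ≤ p →
            GaborQC.IsMFrame φ p
              (GaborQC.gaborSystem (fun i => GaborQC.shiftL2 (ζ i) g) T) := by
  obtain ⟨ρ, -, hρ⟩ := GaborQC.exists_covering_radius_hull hΛ.delone
  obtain ⟨ε, hε, K, hK, hK2, hosc⟩ := GaborQC.exists_oscBound hφ
  obtain ⟨N, ζ, hζ⟩ := GaborQC.exists_finite_net (V := GaborQC.TF d) ρ hε
  -- The net depends only on `ρ` and `ε`, both fixed before `T` and `p` are chosen.
  refine ⟨GaborQC.toL2 φ, GaborQC.memM_one_toL2 φ, N, ζ, fun T hT => ?_⟩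
  have hM : ∀ p : ℝ≥0∞, 1 ≤ p → GaborQC.IsMFrame φ p
      (GaborQC.gaborSystem (fun i => GaborQC.shiftL2 (ζ i) (GaborQC.toL2 φ)) T) := fun p hp =>
    GaborQC.isMFrame_gaborSystem hφ hε hK hK2 hosc ζ hT.1 (hζ T (hρ T hT)) hp
  refine ⟨?_, hM⟩
  have h2 := hM 2 one_le_two
  rw [funext (GaborQC.gaborSystem_toL2 φ ζ T)] at h2 ⊢
  exact GaborQC.isFrame_of_isMFrame_two hφ h2
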